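/- There is a simple nuclear C*-algebra that has irreducible representations both on a separable Hilbert space and on a nonseparable Hilbert space. More precisely, the following holds. For a graph $G=(V,E)$ let $B(G)$ be the universal unital C*-algebra generated by unitaries $u_x$, $x\in V$, such that $u_x^2=1$ for all $x$, $u_xu_y=u_yu_x$ if $x$ and $y$ are not adjacent, and $u_xu_y=-u_yu_x$ if $x$ and $y$ are adjacent. For a family $\mathbb{A}$ of subsets of $\mathbb{N}$ let $G(\mathbb{N},\mathbb{A})$ be the bipartite graph whose vertex set is the disjoint union of $\mathbb{N}$ and $\mathbb{A}$, in which $i\in\mathbb{N}$ and $x\in\mathbb{A}$ are adjacent if and only if $i\in x$ (and there are no other edges). Call $\mathbb{A}$ independent if $\bigcap F\setminus\bigcup F'\neq\emptyset$ for all finite disjoint $F,F'\subseteq\mathbb{A}$ with $F\neq\emptyset$, and dense if it is dense in the power set of $\mathbb{N}$, identified with the product space $\{0,1\}^{\mathbb{N}}$. Then there is a dense independent family $\mathbb{A}$ of subsets of $\mathbb{N}$ of cardinality $2^{\aleph_0}$. For every such $\mathbb{A}$ the C*-algebra $B(G(\mathbb{N},\mathbb{A}))$ exists, is simple and nuclear,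 and has an irreducible representation on a separable Hilbert space and an irreducible representation on a nonseparable Hilbert space. -/

import Mathlib

open scoped TensorProduct

universe w

/-- A family `𝔸` of subsets of `Y` is dense in the power set of `Y`, identified with the product
`2^Y` of discrete two-point spaces. -/
def DenseFamily {Y : Type*} (𝔸 : Set (Set Y)) : Prop :=
  Dense {f : Y → Bool | {i | f i = true} ∈ 𝔸}

/-- A family `𝔸` of subsets of `Y` is independent if `⋂ F \ ⋃ G` is nonempty for all finite
disjoint subsets `F ≠ ∅` and `G` of `𝔸`. -/
def IndependentFamily {Y : Type*} (𝔸 : Set (Set Y)) : Prop :=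
  ∀ F G : Finset (Set Y), (F : Set (Set Y)) ⊆ 𝔸 → (G : Set (Set Y)) ⊆ 𝔸 →
    F.Nonempty → Disjoint F G → ((⋂ x ∈ F, x) \ ⋃ x ∈ G, x).Nonempty

/-- The bipartite graph `G(Y, 𝔸)` on the disjoint union of `Y` and `𝔸`, in which `i ∈ Y` and
`x ∈ 𝔸` are adjacent if and only if `i ∈ x`. -/
def incidenceGraph {Y : Type*} (𝔸 : Set (Set Y)) : SimpleGraph (Y ⊕ 𝔸) where
  Adj
    | Sum.inl i, Sum.inr x => i ∈ x.1
    | Sum.inr x, Sum.inl i => i ∈ x.1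
    | _, _ => False
  symm := ⟨by rintro (i | x) (j | y) h <;> exact h⟩
  loopless := ⟨by rintro (i | x) h <;> exact h⟩

/-- The defining relations of the algebra of a graph `G`: the `v x` are unitaries of square one,
they commute for non-adjacent and anticommute for adjacent vertices. -/
structure SatisfiesGraphRelations {V : Type*} (G : SimpleGraph V) {A : Type*} [CStarAlgebra A]
    (v : V → A) : Prop where
  mem_unitary : ∀ x, v x ∈ unitary A
  sq_eq_one : ∀ x, v x ^ 2 = 1
  commute : ∀ x y, ¬ G.Adj x y → v x * v y = v y * v x
  anticommute : ∀ x y, G.Adj x y → v x * v y = -(v y * v x)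

/-- `B`, with the elements `u x` for `x` a vertex of `G`, is the algebra `B(G)`: the universal unital
C⋆-algebra generated by unitaries `u x` that satisfy the defining relations of `G`.
(The homomorphism in `exists_lift` is unique, because `B` is generated by the `u x`.) -/
structure IsGraphAlgebra {V : Type*} (G : SimpleGraph V) {B : Type*} [CStarAlgebra B]
    (u : V → B) : Prop where
  relations : SatisfiesGraphRelations G u
  generates : (StarAlgebra.adjoin ℂ (Set.range u)).topologicalClosure = ⊤
  exists_lift : ∀ (C : Type w) [CStarAlgebra C] (v : V → C), SatisfiesGraphRelations G v →
    ∃ φ : B →⋆ₐ[ℂ] C, ∀ x, φ (u x) = v x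

/-- A C⋆-algebra is simple if it is nonzero and has no closed two-sided ideals besides `0` and
itself. -/
def IsSimpleCStarAlgebra (A : Type*) [NonUnitalCStarAlgebra A] : Prop :=
  Nontrivial A ∧ ∀ I : TwoSidedIdeal A, IsClosed (I : Set A) → I = ⊥ ∨ I = ⊤

/-- A C⋆-norm on the algebraic tensor product of two C⋆-algebras. -/
structure IsCStarTensorNorm {A C : Type*} [NonUnitalCStarAlgebra A] [NonUnitalCStarAlgebra C]
    (p : Seminorm ℂ (A ⊗[ℂ] C)) : Prop where
  eq_zero : ∀ x, p x = 0 → x = 0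
  mul_le : ∀ x y, p (x * y) ≤ p x * p y
  star_mul_self : ∀ x, p (star x * x) = p x ^ 2

/-- A C⋆-algebra `A` is nuclear if for every C⋆-algebra `C` there is only one C⋆-norm on the
algebraic tensor product of `A` and `C` (the spatial norm always is one). -/
def IsNuclearCStarAlgebra (A : Type*) [NonUnitalCStarAlgebra A] : Prop :=
  ∀ (C : Type w) [NonUnitalCStarAlgebra C] (p q : Seminorm ℂ (A ⊗[ℂ] C)),
    IsCStarTensorNorm p → IsCStarTensorNorm q → p = q

/-- A (unital) representation `π` of `A` on a Hilbert space `H` is irreducible if `H` is nonzero and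
has no closed subspaces invariant under `π` besides `0` and `H`. -/
def IsIrreducibleRep {A : Type*} [CStarAlgebra A] {H : Type*} [NormedAddCommGroup H]
    [InnerProductSpace ℂ H] [CompleteSpace H] (π : A →⋆ₐ[ℂ] (H →L[ℂ] H)) : Prop :=
  Nontrivial H ∧ ∀ K : Submodule ℂ H, IsClosed (K : Set H) →
    (∀ a : A, ∀ ξ ∈ K, π a ξ ∈ K) → K = ⊥ ∨ K = ⊤

/-!
The algebra `B(G)` is a twisted group algebra of the group of finite sets of vertices under symmetric
difference: products of generators depend only on the set of vertices with odd multiplicity, up to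
sign, and a generator commutes with such a word up to a sign (`relSign`). Density of `𝔸` implies that
the members of `𝔸` tell apart the finite subsets of `ℕ` by their signs, and independence implies that
the elements of `ℕ` tell apart the finite subsets of `𝔸`. Together, the signs separate all finite sets
of vertices (`signSeparating_incidenceGraph`). Everything follows from this by averaging: conjugating
by generators and taking means isolates one coefficient of a linear combination of words, without
increasing any seminorm invariant under these conjugations
(`Seminorm.apply_le_apply_sum_of_separated`).

Hence a submultiplicative seminorm below the norm that does not vanish at `1` is definite on the
linear combinations of words. These form a union of finite-dimensional C⋆-algebras, and there the
functional calculus shows that such a seminorm agrees with the norm on elements `star a * a`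
(`SatisfiesGraphRelations.apply_star_mul_self`). Applied to `‖·.1‖` on an algebra generated by pairs
`(u x, v x)`, this gives the universal property for any nonzero algebra generated by a family that
satisfies the relations, so that `B(G)` can be taken as an algebra of operators. Applied to the
distance to a closed ideal, it gives simplicity.

For nuclearity, averaging bounds the coefficients `c s` of `∑ s, W s ⊗ c s` by any C⋆-norm on the
tensor product. So two C⋆-norms are equivalent on the part over finitely many generators, and
equivalent C⋆-norms are equal (`Seminorm.apply_le_apply_of_cstar`); they agree everywhere by density.

Finally, `B(G)` acts on `ℓ²(Finset ℕ)`, where `ℕ` acts by translations and `𝔸` by signs, and on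
`ℓ²(Finset 𝔸)`, with the roles exchanged. As the signs separate the basis vectors, averaging projects
a vector of an invariant subspace to its coordinates, and the translations are transitive on the
basis, so both representations are irreducible. The first space is separable, the second is not
because `𝔸` is uncountable.
-/

/-! ### Seminorms: averaging, and comparison with the C⋆-norm -/

/-- Averaging. Let `T t` be linear maps that do not increase the seminorm `p` and for which all the
`e i` are eigenvectors, with eigenvalues `±1`. If these eigenvalues separate `i₀` from the other
indices, then the projections `(1 ± T t) / 2` remove all the other summands from `∑ i ∈ S, e i`. -/
lemma Seminorm.apply_le_apply_sum_of_separated {V ι τ : Type*} [AddCommGroup V] [Module ℂ V]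
    (p : Seminorm ℂ V) (T : τ → V →ₗ[ℂ] V) (hp : ∀ t v, p (T t v) ≤ p v)
    (σ : τ → ι → ℤˣ) (e : ι → V) {i₀ : ι} (S : Finset ι) (hi₀ : i₀ ∈ S)
    (hT : ∀ t, ∀ i ∈ S, T t (e i) = σ t i • e i)
    (hsep : ∀ i ∈ S, i ≠ i₀ → ∃ t, σ t i ≠ σ t i₀) :
    p (e i₀) ≤ p (∑ i ∈ S, e i) := by
  classical
  induction S using Finset.strongInduction with
  | H S ih =>
    by_cases h : ∃ i ∈ S, i ≠ i₀
    · obtain ⟨i, hi, hne⟩ := h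
      obtain ⟨t, ht⟩ := hsep i hi hne
      set S' := S.filter fun j => σ t j = σ t i₀ with hS'
      have hss : S' ⊂ S :=
        (Finset.ssubset_iff_of_subset (Finset.filter_subset _ _)).2 ⟨i, hi, by simp [ht]⟩
      have key : ∑ j ∈ S', e j =
          (2⁻¹ : ℂ) • (∑ j ∈ S, e j + σ t i₀ • T t (∑ j ∈ S, e j)) := by
        rw [map_sum, Finset.smul_sum, ← Finset.sum_add_distrib, Finset.smul_sum, hS',
          Finset.sum_filter]
        refine Finset.sum_congr rfl fun j hj => ?_
        rw [hT t j hj, smul_smul]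
        rcases Int.units_eq_one_or (σ t j) with h1 | h1 <;>
          rcases Int.units_eq_one_or (σ t i₀) with h2 | h2 <;>
          simp [h1, h2, ← two_smul ℂ (e j), smul_smul]
      refine (ih S' hss (by simp [hS', hi₀]) (fun t i hi => hT t i (hss.1 hi))
        fun i hi => hsep i (hss.1 hi)).trans ?_
      have hsign : p (σ t i₀ • T t (∑ j ∈ S, e j)) ≤ p (∑ j ∈ S, e j) := by
        refine le_trans (le_of_eq ?_) (hp t _)
        rcases Int.units_eq_one_or (σ t i₀) with h2 | h2 <;> simp [h2]
      rw [key, map_smul_eq_mul]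
      have := map_add_le_add p (∑ j ∈ S, e j) (σ t i₀ • T t (∑ j ∈ S, e j))
      rw [norm_inv, Complex.norm_ofNat]
      linarith
    · push Not at h
      have : S = {i₀} := by
        ext j
        simp only [Finset.mem_singleton]
        exact ⟨h j, fun hj => hj ▸ hi₀⟩
      simp [this]

/-- A submultiplicative seminorm below the C⋆-norm agrees with it at a normal element `h`, unless
it vanishes at a nonzero element of the C⋆-algebra generated by `h`.
If `p h < δ < ‖h‖`, the functional calculus gives `k ≠ 0` and `g` with `g * h * k = k` and
`‖g‖ ≤ δ⁻¹`, so that `p k ≤ δ⁻¹ * p h * p k < p k`. -/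
lemma Seminorm.norm_le_apply_of_isStarNormal {E : Type*} [NonUnitalCStarAlgebra E]
    (p : Seminorm ℂ E) (hmul : ∀ x y, p (x * y) ≤ p x * p y) (hle : ∀ x, p x ≤ ‖x‖)
    (h : E) [hn : IsStarNormal h]
    (hp : ∀ k ∈ NonUnitalStarAlgebra.elemental ℂ h, p k = 0 → k = 0) : ‖h‖ ≤ p h := by
  by_contra! hlt
  obtain ⟨δ, hδ, hδ'⟩ := exists_between hlt
  have hδ0 : 0 < δ := (apply_nonneg p h).trans_lt hδ
  have hm : ∀ t : ℂ, 0 < max ‖t‖ δ := fun t => lt_max_of_lt_right hδ0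
  -- `g t = t⁻¹` wherever `f t ≠ 0`, that is, for `‖t‖ > δ`.
  let f : ℂ → ℂ := fun t => ((max (‖t‖ - δ) 0 : ℝ) : ℂ)
  let g : ℂ → ℂ := fun t => star t / ((max ‖t‖ δ : ℝ) : ℂ) ^ 2
  have hf : Continuous f := by fun_prop
  have hg : Continuous g := by
    refine Continuous.div (by fun_prop) (by fun_prop) fun t => ?_
    exact pow_ne_zero _ (Complex.ofReal_ne_zero.2 (hm t).ne')
  have hf0 : f 0 = 0 := by simp [f, hδ0.le]
  have hg0 : g 0 = 0 := by simp [g]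
  have hgn : ‖cfcₙ g h‖ ≤ δ⁻¹ := by
    refine norm_cfcₙ_le fun t _ => ?_
    simp only [g, norm_div, norm_star, norm_pow, Complex.norm_real, Real.norm_eq_abs,
      abs_of_pos (hm t)]
    rw [div_le_iff₀ (pow_pos (hm t) 2), inv_mul_eq_div, le_div_iff₀ hδ0, sq]
    gcongr
    · exact le_max_left _ _
    · exact le_max_right _ _
  have hk : cfcₙ f h ≠ 0 := by
    intro h0
    obtain ⟨t, ht, hth⟩ := (IsGreatest.norm_cfcₙ (id : ℂ → ℂ) h).1
    rw [cfcₙ_id ℂ h] at hth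
    have := norm_apply_le_norm_cfcₙ f h ht (by fun_prop) hf0
    rw [h0, norm_zero] at this
    simp only [f, Complex.norm_real, Real.norm_eq_abs, id] at this hth
    have h1 : 0 < max (‖t‖ - δ) 0 := lt_max_of_lt_left (by linarith)
    rw [abs_of_pos h1] at this
    linarith
  have hghk : cfcₙ g h * h * cfcₙ f h = cfcₙ f h := by
    nth_rw 2 [← cfcₙ_id ℂ h]
    rw [← cfcₙ_mul g id h (by fun_prop) hg0 (by fun_prop) rfl,
      ← cfcₙ_mul (fun t => g t * id t) f h (by fun_prop) (by simp) (by fun_prop) hf0]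
    congr 1
    ext t
    by_cases ht : ‖t‖ ≤ δ
    · simp [f, ht]
    · push Not at ht
      have ht0 : (‖t‖ : ℂ) ≠ 0 := Complex.ofReal_ne_zero.2 (hδ0.trans ht).ne'
      have : star t * t = (‖t‖ : ℂ) ^ 2 := by
        rw [mul_comm]; exact Complex.mul_conj' t
      simp only [g, id, max_eq_left ht.le]
      rw [div_mul_eq_mul_div, this, div_self (pow_ne_zero _ ht0), one_mul]
  have hpk : 0 < p (cfcₙ f h) :=
    (apply_nonneg p _).lt_of_ne' fun h0 => hk (hp _ (cfcₙ_mem_elemental f h) h0)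
  have : p (cfcₙ f h) ≤ δ⁻¹ * p h * p (cfcₙ f h) := by
    conv_lhs => rw [← hghk]
    refine (hmul _ _).trans ?_
    gcongr
    exact (hmul _ _).trans (by gcongr; exact (hle _).trans hgn)
  have h2 : δ⁻¹ * p h < 1 := by rwa [inv_mul_lt_iff₀ hδ0, mul_one]
  nlinarith

lemma Seminorm.apply_star_of_cstar {E : Type*} [NonUnitalRing E] [StarRing E] [Module ℂ E]
    (p : Seminorm ℂ E) (hmul : ∀ x y, p (x * y) ≤ p x * p y)
    (hstar : ∀ x, p (star x * x) = p x ^ 2) (x : E) : p (star x) = p x := by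
  have key : ∀ x, p x ≤ p (star x) := fun x => by
    have h1 : p x ^ 2 ≤ p (star x) * p x := hstar x ▸ hmul _ _
    rcases (apply_nonneg p x).eq_or_lt' with h0 | h0
    · rw [h0]; exact apply_nonneg p _
    · nlinarith
  exact le_antisymm (by simpa using key (star x)) (key x)

/-- The upper bound in the uniqueness of the C⋆-norm. For self-adjoint `h` with `‖h‖ ≤ 1`, left
multiplication by `h` is the mean of those by `h ± i √(1 - h²)`, which are isometric for `p` because
these elements are unitary. In an algebra without unit, `1 - √(1 - h²)` still is an element. -/
lemma Seminorm.apply_le_norm_of_cstar {E : Type*} [NonUnitalCStarAlgebra E]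
    (p : Seminorm ℂ E) (hstar : ∀ x, p (star x * x) = p x ^ 2) (x : E) : p x ≤ ‖x‖ := by
  have main : ∀ h : E, IsSelfAdjoint h → ‖h‖ ≤ 1 → ∀ x, p (h * x) ≤ p x := by
    intro h hh hh1 x
    let f : ℝ → ℝ := fun t => 1 - √(1 - t ^ 2)
    have hf : Continuous f := by fun_prop
    have hf0 : f 0 = 0 := by simp [f]
    set d := cfcₙ f h with hd
    have hds : star d = d := (cfcₙ_predicate f h : IsSelfAdjoint d).star_eq
    have hdd : d * d = d + d - h * h := by
      have h1 : h * h = cfcₙ (fun t : ℝ => t * t) h := by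
        conv_lhs => rw [← cfcₙ_id ℝ h]
        rw [← cfcₙ_mul id id h]
        rfl
      rw [h1, hd, ← cfcₙ_mul f f h, ← cfcₙ_add f f h, ← cfcₙ_sub _ _ h]
      refine cfcₙ_congr fun t ht => ?_
      have ht1 : ‖t‖ ≤ 1 := by
        have := norm_apply_le_norm_cfcₙ (id : ℝ → ℝ) h ht
        rw [cfcₙ_id ℝ h] at this
        exact this.trans hh1
      have ht2 : 0 ≤ 1 - t ^ 2 := by
        rw [Real.norm_eq_abs, abs_le] at ht1
        nlinarith
      have := Real.mul_self_sqrt ht2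
      simp only [f]
      nlinarith
    have hcomm : h * d = d * h := by
      conv_lhs => rw [← cfcₙ_id ℝ h]
      conv_rhs => rw [← cfcₙ_id ℝ h]
      exact cfcₙ_commute_cfcₙ id f h
    have iso : ∀ c : ℂ, star c = -c → c * c = -1 → p (h * x + c • (x - d * x)) = p x := by
      intro c hc hc2
      rw [← sq_eq_sq₀ (apply_nonneg _ _) (apply_nonneg _ _), ← hstar, ← hstar]
      congr 1
      have e1 : star x * (h * (h * x)) = star x * (d * x) + star x * (d * x)
          - star x * (d * (d * x)) := by
        have : h * h = d + d - d * d := by rw [hdd]; abel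
        rw [← mul_assoc h h, this]
        noncomm_ring
      have e2 : star x * (h * (d * x)) = star x * (d * (h * x)) := by
        rw [← mul_assoc h, hcomm, mul_assoc]
      have hcc : ∀ z : E, c • c • z = -z := fun z => by rw [smul_smul, hc2, neg_one_smul]
      simp only [star_add, star_smul, star_sub, star_mul, hds, hh.star_eq, hc, mul_add, add_mul,
        mul_sub, sub_mul, smul_mul_assoc, mul_smul_comm, mul_assoc, smul_sub, smul_add, hcc, e1, e2,
        neg_smul, smul_neg, neg_mul, neg_neg]
      abel
    have e : h * x = (2⁻¹ : ℂ) • ((h * x + Complex.I • (x - d * x)) +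
        (h * x + (-Complex.I) • (x - d * x))) := by
      rw [neg_smul, add_add_add_comm, add_neg_cancel, add_zero, ← two_smul ℂ, smul_smul]
      norm_num
    rw [e, map_smul_eq_mul]
    have h1 := iso Complex.I (by simp) (by simp)
    have h2 := iso (-Complex.I) (by simp) (by simp)
    have h3 := map_add_le_add p (h * x + Complex.I • (x - d * x))
      (h * x + (-Complex.I) • (x - d * x))
    rw [h1, h2] at h3
    rw [norm_inv, Complex.norm_ofNat]
    linarith
  have sa : ∀ h : E, IsSelfAdjoint h → p h ≤ ‖h‖ := by
    intro h hh
    rcases (norm_nonneg h).eq_or_lt' with h0 | h0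
    · rw [norm_eq_zero.1 h0, map_zero, norm_zero]
    rcases (apply_nonneg p h).eq_or_lt' with hp0 | hp0
    · rw [hp0]; exact h0.le
    have h1 := main ((‖h‖⁻¹ : ℝ) • h) ((IsSelfAdjoint.all _).smul hh)
      (by rw [norm_smul, norm_inv, norm_norm, inv_mul_cancel₀ h0.ne']) h
    have h2 : p h ^ 2 = p (h * h) := by rw [← hstar, hh.star_eq]
    rw [smul_mul_assoc, ← Complex.coe_smul, map_smul_eq_mul, ← h2, Complex.norm_real, norm_inv,
      norm_norm, inv_mul_le_iff₀ h0] at h1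
    nlinarith
  have := sa (star x * x) (IsSelfAdjoint.star_mul_self x)
  rw [hstar, CStarRing.norm_star_mul_self, ← sq] at this
  exact (sq_le_sq₀ (apply_nonneg _ _) (norm_nonneg _)).1 this

/-- A C⋆-algebra has only one C⋆-norm, also among the norms that are not complete. -/
lemma Seminorm.apply_eq_norm_of_cstar {E : Type*} [NonUnitalCStarAlgebra E]
    (p : Seminorm ℂ E) (hmul : ∀ x y, p (x * y) ≤ p x * p y)
    (hstar : ∀ x, p (star x * x) = p x ^ 2) (h0 : ∀ x, p x = 0 → x = 0) (x : E) : p x = ‖x‖ := by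
  have hle := p.apply_le_norm_of_cstar hstar
  refine le_antisymm (hle x) ?_
  have : IsStarNormal (star x * x) := (IsSelfAdjoint.star_mul_self x).isStarNormal
  have := p.norm_le_apply_of_isStarNormal hmul hle (star x * x) fun k _ => h0 k
  rw [hstar, CStarRing.norm_star_mul_self, ← sq] at this
  exact (sq_le_sq₀ (norm_nonneg _) (apply_nonneg _ _)).1 this

/-- Of two C⋆-seminorms, `p ≤ K * q` on a ⋆-subalgebra implies `p ≤ q` there: the constant
disappears if one takes roots in `p h ^ 2 ^ n = p (h ^ 2 ^ n) ≤ K * q h ^ 2 ^ n`. -/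
lemma Seminorm.apply_le_apply_of_cstar {D : Type*} [NonUnitalRing D] [StarRing D] [Module ℂ D]
    {p q : Seminorm ℂ D} (hp : ∀ x, p (star x * x) = p x ^ 2)
    (hq : ∀ x, q (star x * x) = q x ^ 2) {M : Set D} (hM : ∀ x ∈ M, ∀ y ∈ M, x * y ∈ M)
    (hMs : ∀ x ∈ M, star x ∈ M) {K : ℝ} (hK : ∀ x ∈ M, p x ≤ K * q x) {x : D} (hx : x ∈ M) :
    p x ≤ q x := by
  have powers : ∀ n : ℕ, ∃ y ∈ M, p y = p (star x * x) ^ 2 ^ n ∧ q y = q (star x * x) ^ 2 ^ n ∧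
      IsSelfAdjoint y := by
    intro n
    induction n with
    | zero => exact ⟨_, hM _ (hMs _ hx) _ hx, by simp, by simp, IsSelfAdjoint.star_mul_self x⟩
    | succ n ih =>
      obtain ⟨y, hy, hpy, hqy, hys⟩ := ih
      refine ⟨star y * y, hM _ (hMs _ hy) _ hy, ?_, ?_, IsSelfAdjoint.star_mul_self y⟩
      · rw [hp, hpy, ← pow_mul, pow_succ]
      · rw [hq, hqy, ← pow_mul, pow_succ]
  suffices h : p (star x * x) ≤ q (star x * x) by
    rw [hp, hq] at h
    exact (sq_le_sq₀ (apply_nonneg _ _) (apply_nonneg _ _)).1 h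
  by_contra! hlt
  set a := p (star x * x)
  set b := q (star x * x)
  have hb : 0 ≤ b := apply_nonneg _ _
  have bound : ∀ n : ℕ, a ^ 2 ^ n ≤ K * b ^ 2 ^ n := fun n => by
    obtain ⟨y, hy, hpy, hqy, -⟩ := powers n
    rw [← hpy, ← hqy]
    exact hK y hy
  rcases hb.eq_or_lt' with hb0 | hb0
  · have := bound 0
    simp [hb0] at this
    linarith
  · obtain ⟨n, hn⟩ := pow_unbounded_of_one_lt K ((one_lt_div hb0).2 hlt)
    have h1 := bound n
    have h2 : (a / b) ^ n ≤ (a / b) ^ 2 ^ n :=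
      pow_le_pow_right₀ ((one_lt_div hb0).2 hlt).le n.lt_two_pow_self.le
    rw [div_pow a b (2 ^ n), le_div_iff₀ (by positivity)] at h2
    have h3 : K * b ^ 2 ^ n < (a / b) ^ n * b ^ 2 ^ n := by gcongr
    linarith

/-! ### Words in the generators of a graph algebra -/

open Classical in
/-- The parity, as a sign `±1`, of the number of elements of `s` that `z` is related to. If `R` is the
adjacency of a graph, the generator at `z` commutes up to this sign with the product of the
generators at the vertices in `s`. -/
noncomputable def relSign {Z X : Type*} (R : Z → X → Prop) (z : Z) (s : Finset X) : ℤˣ :=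
  ∏ x ∈ s, if R z x then -1 else 1

/-- Different finite sets are told apart by their signs. For the adjacency of a graph on `V` this says
that the bicharacter on `⨁_V ℤ/2` whose twisted group algebra is the graph algebra is
nondegenerate. -/
def SignSeparating {Z X : Type*} (R : Z → X → Prop) : Prop :=
  ∀ s s' : Finset X, s ≠ s' → ∃ z, relSign R z s ≠ relSign R z s'

/-- The product of the `w x` with `x ∈ s`, in the arbitrary order of `Finset.toList`; for generators
of a graph algebra any other order gives the same product up to sign. -/
noncomputable def finsetWord {V M : Type*} [Monoid M] (w : V → M) (s : Finset V) : M :=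
  (s.toList.map w).prod

@[simp]
lemma finsetWord_empty {V M : Type*} [Monoid M] (w : V → M) : finsetWord w ∅ = 1 := by
  simp [finsetWord]

namespace SatisfiesGraphRelations

variable {V : Type*} {G : SimpleGraph V} {E : Type*} [CStarAlgebra E] {w : V → E}

lemma mul_self (hw : SatisfiesGraphRelations G w) (x : V) : w x * w x = 1 := by
  rw [← sq, hw.sq_eq_one]

lemma star_eq (hw : SatisfiesGraphRelations G w) (x : V) : star (w x) = w x := by
  rw [← mul_one (star (w x)), ← hw.mul_self x, ← mul_assoc,
    Unitary.star_mul_self_of_mem (hw.mem_unitary x), one_mul]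

lemma norm_le_one (hw : SatisfiesGraphRelations G w) (x : V) : ‖w x‖ ≤ 1 :=
  (subsingleton_or_nontrivial E).elim (fun _ => by simp [Subsingleton.elim (w x) 0])
    fun _ => (CStarRing.norm_of_mem_unitary (hw.mem_unitary x)).le

open Classical in
lemma mul_eq_smul (hw : SatisfiesGraphRelations G w) (x y : V) :
    w x * w y = (if G.Adj x y then -1 else 1 : ℤˣ) • (w y * w x) := by
  split_ifs with h
  · simp [hw.anticommute x y h]
  · simp [hw.commute x y h]

lemma finsetWord_mem_unitary (hw : SatisfiesGraphRelations G w) (s : Finset V) :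
    finsetWord w s ∈ unitary E :=
  Submonoid.list_prod_mem _ fun a ha => by
    obtain ⟨x, -, rfl⟩ := List.mem_map.1 ha
    exact hw.mem_unitary x

lemma mul_finsetWord_mul (hw : SatisfiesGraphRelations G w) (t : V) (s : Finset V) :
    w t * finsetWord w s * w t = relSign G.Adj t s • finsetWord w s := by
  classical
  have key : ∀ l : List V, w t * (l.map w).prod =
      (l.map fun x => (if G.Adj t x then -1 else 1 : ℤˣ)).prod • ((l.map w).prod * w t) := by
    intro l
    induction l with
    | nil => simp
    | cons x l ih =>
      simp only [List.map_cons, List.prod_cons]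
      rw [← mul_assoc, hw.mul_eq_smul t x, smul_mul_assoc, mul_assoc, ih, mul_smul_comm, smul_smul,
        mul_assoc]
  rw [finsetWord, key, smul_mul_assoc, mul_assoc, hw.mul_self, mul_one, relSign,
    Finset.prod_map_toList]

lemma exists_smul_of_perm (hw : SatisfiesGraphRelations G w) {l l' : List V} (h : l.Perm l') :
    ∃ ε : ℤˣ, (l.map w).prod = ε • (l'.map w).prod := by
  induction h with
  | nil => exact ⟨1, by simp⟩
  | cons x _ ih =>
    obtain ⟨ε, h⟩ := ih
    exact ⟨ε, by simp [h, mul_smul_comm]⟩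
  | swap x y l =>
    classical
    refine ⟨if G.Adj y x then -1 else 1, ?_⟩
    simp only [List.map_cons, List.prod_cons]
    rw [← mul_assoc, hw.mul_eq_smul y x, smul_mul_assoc, mul_assoc]
  | trans _ _ ih ih' =>
    obtain ⟨ε, h⟩ := ih
    obtain ⟨ε', h'⟩ := ih'
    exact ⟨ε * ε', by rw [h, h', smul_smul]⟩

lemma exists_mul_finsetWord [DecidableEq V] (hw : SatisfiesGraphRelations G w) (x : V)
    (s : Finset V) : ∃ s' ⊆ insert x s, ∃ ε : ℤˣ, w x * finsetWord w s = ε • finsetWord w s' := by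
  have key : ∀ s : Finset V, x ∉ s →
      ∃ ε : ℤˣ, finsetWord w (insert x s) = ε • (w x * finsetWord w s) := fun s hx => by
    simpa [finsetWord] using hw.exists_smul_of_perm (Finset.toList_insert hx)
  by_cases hx : x ∈ s
  · obtain ⟨ε, h⟩ := key _ (Finset.notMem_erase x s)
    refine ⟨s.erase x, (Finset.erase_subset _ _).trans (Finset.subset_insert _ _), ε, ?_⟩
    rw [Finset.insert_erase hx] at h
    rw [h, mul_smul_comm, ← mul_assoc, hw.mul_self, one_mul]
  · obtain ⟨ε, h⟩ := key s hx
    exact ⟨insert x s, subset_rfl, ε⁻¹, by rw [h, inv_smul_smul]⟩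

/-- The algebra generated by finitely many `w x` is spanned by finitely many words. -/
lemma exists_eq_sum_of_mem_adjoin (hw : SatisfiesGraphRelations G w) {F : Finset V} {a : E}
    (ha : a ∈ StarAlgebra.adjoin ℂ (w '' F)) :
    ∃ c : Finset V → ℂ, a = ∑ s ∈ F.powerset, c s • finsetWord w s := by
  classical
  set M := Submodule.span ℂ (finsetWord w '' (F.powerset : Set (Finset V))) with hM
  have hstar : star (w '' F) = w '' (F : Set V) := by
    ext a
    constructor
    · rintro ⟨x, hx, h⟩
      exact ⟨x, hx, by rw [← hw.star_eq x, h, star_star]⟩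
    · rintro ⟨x, hx, rfl⟩
      exact ⟨x, hx, (hw.star_eq x).symm⟩
  have ha' : a ∈ Algebra.adjoin ℂ (w '' (F : Set V)) := by
    rw [← StarSubalgebra.mem_toSubalgebra, StarAlgebra.adjoin_toSubalgebra, hstar,
      Set.union_self] at ha
    exact ha
  have stab : ∀ b ∈ Algebra.adjoin ℂ (w '' (F : Set V)), ∀ y ∈ M, b * y ∈ M := by
    intro b hb
    induction hb using Algebra.adjoin_induction with
    | mem b hb =>
      obtain ⟨x, hx, rfl⟩ := hb
      intro y hy
      induction hy using Submodule.span_induction with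
      | mem y hy =>
        obtain ⟨s, hs, rfl⟩ := hy
        obtain ⟨s', hs', ε, h⟩ := hw.exists_mul_finsetWord x s
        rw [h]
        have hs'F : s' ⊆ F :=
          hs'.trans (Finset.insert_subset hx (Finset.mem_powerset.1 (Finset.mem_coe.1 hs)))
        have hmem : finsetWord w s' ∈ M :=
          Submodule.subset_span ⟨s', Finset.mem_coe.2 (Finset.mem_powerset.2 hs'F), rfl⟩
        rcases Int.units_eq_one_or ε with h | h <;> simpa [h] using hmem
      | zero => simp
      | add y z _ _ hy hz => rw [mul_add]; exact M.add_mem hy hz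
      | smul c y _ hy => rw [mul_smul_comm]; exact M.smul_mem c hy
    | algebraMap c =>
      intro y hy
      rw [← Algebra.smul_def]
      exact M.smul_mem c hy
    | add b c _ _ hb hc => intro y hy; rw [add_mul]; exact M.add_mem (hb y hy) (hc y hy)
    | mul b c _ _ hb hc => intro y hy; rw [mul_assoc]; exact hb _ (hc y hy)
  have h1 : (1 : E) ∈ M := Submodule.subset_span ⟨∅, by simp, by simp⟩
  have haM := stab a ha' 1 h1
  rw [mul_one, hM, Submodule.mem_span_image_finset_iff_exists_fun'] at haM
  obtain ⟨c, hc⟩ := haM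
  exact ⟨c, hc.symm⟩

lemma isClosed_adjoin_image (hw : SatisfiesGraphRelations G w) (F : Finset V) :
    IsClosed (StarAlgebra.adjoin ℂ (w '' (F : Set V)) : Set E) := by
  let N := Submodule.span ℂ (finsetWord w '' (F.powerset : Set (Finset V)))
  have : FiniteDimensional ℂ N :=
    FiniteDimensional.span_of_finite ℂ (F.powerset.finite_toSet.image _)
  have hle : Subalgebra.toSubmodule (StarAlgebra.adjoin ℂ (w '' (F : Set V))).toSubalgebra ≤ N := by
    intro a ha
    obtain ⟨c, rfl⟩ := hw.exists_eq_sum_of_mem_adjoin ha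
    exact N.sum_mem fun s hs => N.smul_mem _ (Submodule.subset_span ⟨s, hs, rfl⟩)
  have := Submodule.finiteDimensional_of_le hle
  exact Submodule.closed_of_finiteDimensional
    (Subalgebra.toSubmodule (StarAlgebra.adjoin ℂ (w '' (F : Set V))).toSubalgebra)

end SatisfiesGraphRelations

lemma exists_mem_adjoin_image {V E : Type*} [CStarAlgebra E] {w : V → E} {a : E}
    (ha : a ∈ StarAlgebra.adjoin ℂ (Set.range w)) :
    ∃ F : Finset V, a ∈ StarAlgebra.adjoin ℂ (w '' F) := by
  classical
  have mono : ∀ F F' : Finset V, F ⊆ F' →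
      StarAlgebra.adjoin ℂ (w '' F) ≤ StarAlgebra.adjoin ℂ (w '' F') := fun F F' h =>
    StarAlgebra.adjoin_mono (Set.image_mono (Finset.coe_subset.2 h))
  induction ha using StarAlgebra.adjoin_induction with
  | mem x hx =>
    obtain ⟨y, rfl⟩ := hx
    exact ⟨{y}, StarAlgebra.subset_adjoin _ _ ⟨y, by simp, rfl⟩⟩
  | algebraMap c => exact ⟨∅, algebraMap_mem _ c⟩
  | add x y _ _ hx hy =>
    obtain ⟨F, hF⟩ := hx
    obtain ⟨F', hF'⟩ := hy
    exact ⟨F ∪ F', add_mem (mono _ _ Finset.subset_union_left hF)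
      (mono _ _ Finset.subset_union_right hF')⟩
  | mul x y _ _ hx hy =>
    obtain ⟨F, hF⟩ := hx
    obtain ⟨F', hF'⟩ := hy
    exact ⟨F ∪ F', mul_mem (mono _ _ Finset.subset_union_left hF)
      (mono _ _ Finset.subset_union_right hF')⟩
  | star x _ hx =>
    obtain ⟨F, hF⟩ := hx
    exact ⟨F, star_mem hF⟩

/-! ### Rigidity of the norm on a graph algebra -/

namespace SatisfiesGraphRelations

variable {V : Type*} {G : SimpleGraph V} {E : Type*} [CStarAlgebra E] {w : V → E}

/-- A submultiplicative seminorm below the norm that does not vanish at `1` is definite on linear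
combinations of words: by averaging, it bounds each coefficient. -/
lemma eq_zero_of_apply_eq_zero (hw : SatisfiesGraphRelations G w) (hG : SignSeparating G.Adj)
    (p : Seminorm ℂ E) (hmul : ∀ x y, p (x * y) ≤ p x * p y) (hle : ∀ x, p x ≤ ‖x‖)
    (h1 : p 1 ≠ 0) {a : E} (ha : a ∈ StarAlgebra.adjoin ℂ (Set.range w)) (h0 : p a = 0) :
    a = 0 := by
  obtain ⟨F, hF⟩ := exists_mem_adjoin_image ha
  obtain ⟨c, rfl⟩ := hw.exists_eq_sum_of_mem_adjoin hF
  refine Finset.sum_eq_zero fun s₀ hs₀ => ?_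
  have key := p.apply_le_apply_sum_of_separated
    (fun t : V => LinearMap.mulLeftRight ℂ (w t, w t))
    (fun t v => by
      rw [LinearMap.mulLeftRight_apply]
      calc p (w t * v * w t) ≤ p (w t) * p v * p (w t) :=
            (hmul _ _).trans (by gcongr; exact hmul _ _)
        _ ≤ 1 * p v * 1 := by gcongr <;> exact (hle _).trans (hw.norm_le_one t)
        _ = p v := by ring)
    (relSign G.Adj) (fun s => c s • finsetWord w s) F.powerset hs₀
    (fun t s _ => by
      rw [LinearMap.mulLeftRight_apply, mul_smul_comm, smul_mul_assoc, hw.mul_finsetWord_mul,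
        smul_comm])
    (fun s _ hs => hG s s₀ hs)
  rw [h0, map_smul_eq_mul] at key
  have hW : p (finsetWord w s₀) ≠ 0 := fun hW => h1 <| by
    refine le_antisymm ?_ (apply_nonneg p _)
    rw [← Unitary.star_mul_self_of_mem (hw.finsetWord_mem_unitary s₀)]
    exact (hmul _ _).trans (by rw [hW, mul_zero])
  have := mul_eq_zero.1 (le_antisymm key (by positivity))
  rw [norm_eq_zero.1 (this.resolve_right hW), zero_smul]

/-- On the C⋆-algebra generated by the `w x`, a submultiplicative seminorm below the norm that does
not vanish at `1` agrees with the norm on elements `star a * a`. -/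
lemma apply_star_mul_self (hw : SatisfiesGraphRelations G w) (hG : SignSeparating G.Adj)
    (p : Seminorm ℂ E) (hmul : ∀ x y, p (x * y) ≤ p x * p y) (hle : ∀ x, p x ≤ ‖x‖)
    (h1 : p 1 ≠ 0) {a : E} (ha : a ∈ (StarAlgebra.adjoin ℂ (Set.range w)).topologicalClosure) :
    p (star a * a) = ‖a‖ ^ 2 := by
  have hp : Continuous p := by
    refine Seminorm.continuous_of_le (q := normSeminorm ℂ E) ?_ hle
    exact continuous_norm
  have hclosed : IsClosed {a : E | p (star a * a) = ‖a‖ ^ 2} :=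
    isClosed_eq (hp.comp (by fun_prop)) (by fun_prop)
  refine closure_minimal (fun a ha => ?_) hclosed ha
  refine le_antisymm ((hle _).trans (by rw [CStarRing.norm_star_mul_self, sq])) ?_
  obtain ⟨F, hF⟩ := exists_mem_adjoin_image ha
  have : IsStarNormal (star a * a) := (IsSelfAdjoint.star_mul_self a).isStarNormal
  rw [sq, ← CStarRing.norm_star_mul_self]
  refine p.norm_le_apply_of_isStarNormal hmul hle _ fun k hk hk0 => ?_
  refine hw.eq_zero_of_apply_eq_zero hG p hmul hle h1 ?_ hk0
  have hsub : NonUnitalStarAlgebra.elemental ℂ (star a * a) ≤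
      (StarAlgebra.adjoin ℂ (w '' (F : Set V))).toNonUnitalStarSubalgebra :=
    NonUnitalStarAlgebra.elemental.le_of_mem (hw.isClosed_adjoin_image F)
      (mul_mem (star_mem hF) hF)
  exact StarAlgebra.adjoin_mono (Set.image_subset_range _ _) (hsub hk)

end SatisfiesGraphRelations

/-! ### Universality -/

section Universal

variable {V : Type*} {G : SimpleGraph V}

lemma SatisfiesGraphRelations.prodMk {B C : Type*} [CStarAlgebra B] [CStarAlgebra C] {u : V → B}
    {v : V → C} (hu : SatisfiesGraphRelations G u) (hv : SatisfiesGraphRelations G v) :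
    SatisfiesGraphRelations G fun x => (u x, v x) where
  mem_unitary x := by
    refine Unitary.mem_iff.2 ⟨Prod.ext ?_ ?_, Prod.ext ?_ ?_⟩
    · exact Unitary.star_mul_self_of_mem (hu.mem_unitary x)
    · exact Unitary.star_mul_self_of_mem (hv.mem_unitary x)
    · exact Unitary.mul_star_self_of_mem (hu.mem_unitary x)
    · exact Unitary.mul_star_self_of_mem (hv.mem_unitary x)
  sq_eq_one x := Prod.ext (hu.sq_eq_one x) (hv.sq_eq_one x)
  commute x y h := Prod.ext (hu.commute x y h) (hv.commute x y h)
  anticommute x y h := Prod.ext (hu.anticommute x y h) (hv.anticommute x y h)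

/-- If signs separate the finite sets of vertices, then any nonzero C⋆-algebra generated by elements
that satisfy the graph relations is universal. Given another such family `v` in `C`, the projection
to `B` is isometric on the C⋆-subalgebra of `B × C` generated by the pairs `(u x, v x)`, so this
subalgebra is the graph of a homomorphism `B → C`. -/
theorem SatisfiesGraphRelations.isGraphAlgebra {B : Type*} [CStarAlgebra B] [Nontrivial B]
    {u : V → B} (hu : SatisfiesGraphRelations G u) (hG : SignSeparating G.Adj)
    (hgen : (StarAlgebra.adjoin ℂ (Set.range u)).topologicalClosure = ⊤) :
    IsGraphAlgebra.{w} G u where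
  relations := hu
  generates := hgen
  exists_lift C _ v hv := by
    -- The graph of the homomorphism to be constructed.
    set D := (StarAlgebra.adjoin ℂ (Set.range fun x => (u x, v x))).topologicalClosure with hD
    have hDc : IsClosed (D : Set (B × C)) := StarSubalgebra.isClosed_topologicalClosure _
    let p : Seminorm ℂ (B × C) := (normSeminorm ℂ B).comp (LinearMap.fst ℂ B C)
    have hp : ∀ z, p z = ‖z.1‖ := fun z => rfl
    have hmem : ∀ x, (u x, v x) ∈ D := fun x =>
      StarSubalgebra.le_topologicalClosure _ (StarAlgebra.subset_adjoin _ _ ⟨x, rfl⟩)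
    let ψ : D →⋆ₐ[ℂ] B := (StarAlgHom.fst ℂ B C).comp D.subtype
    have hψ : ∀ d : D, ψ d = (d : B × C).1 := fun d => rfl
    have hiso : Isometry ψ := by
      rw [AddMonoidHomClass.isometry_iff_norm]
      intro d
      have := (hu.prodMk hv).apply_star_mul_self hG p
        (fun x y => norm_mul_le x.1 y.1) (fun x => norm_fst_le x)
        (by rw [hp]; simp) d.2
      rw [hp, Prod.fst_mul, Prod.fst_star, CStarRing.norm_star_mul_self, ← sq] at this
      exact (sq_eq_sq₀ (norm_nonneg _) (norm_nonneg _)).1 this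
    have hDcomplete : CompleteSpace D := hDc.completeSpace_coe
    have hsurj : Function.Surjective ψ := by
      have hle : (StarAlgebra.adjoin ℂ (Set.range u)).topologicalClosure ≤ ψ.range := by
        refine StarSubalgebra.topologicalClosure_minimal (StarAlgebra.adjoin_le ?_) ?_
        · rintro _ ⟨x, rfl⟩
          exact ⟨⟨_, hmem x⟩, rfl⟩
        · exact hiso.isClosedEmbedding.isClosed_range
      intro b
      have : b ∈ ψ.range := hle (hgen ▸ StarSubalgebra.mem_top)
      exact this
    let e := StarAlgEquiv.ofBijective ψ ⟨hiso.injective, hsurj⟩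
    refine ⟨((StarAlgHom.snd ℂ B C).comp D.subtype).comp (e.symm : B →⋆ₐ[ℂ] D), fun x => ?_⟩
    have : e.symm (u x) = ⟨_, hmem x⟩ := by
      rw [StarAlgEquiv.symm_apply_eq]
      rfl
    change ((e.symm (u x) : D) : B × C).2 = v x
    rw [this]

end Universal

/-! ### Simplicity -/

/-- The distance to a subspace, as a seminorm. -/
noncomputable def Submodule.quotientSeminorm {V : Type*} [SeminormedAddCommGroup V]
    [NormedSpace ℂ V] (K : Submodule ℂ V) : Seminorm ℂ V :=
  (normSeminorm ℂ (V ⧸ K)).comp K.mkQ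

section QuotientSeminorm

variable {V : Type*} [SeminormedAddCommGroup V] [NormedSpace ℂ V] (K : Submodule ℂ V)

lemma Submodule.quotientSeminorm_le_norm (v : V) : K.quotientSeminorm v ≤ ‖v‖ :=
  Submodule.Quotient.norm_mk_le K v

lemma Submodule.quotientSeminorm_congr {v v' : V} (h : v - v' ∈ K) :
    K.quotientSeminorm v = K.quotientSeminorm v' :=
  congrArg norm ((Submodule.Quotient.eq K).2 h)

lemma Submodule.quotientSeminorm_eq_zero_of_mem {v : V} (h : v ∈ K) : K.quotientSeminorm v = 0 := by
  rw [K.quotientSeminorm_congr (v' := 0) (by simpa using h), map_zero]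

lemma Submodule.mem_of_quotientSeminorm_eq_zero (hK : IsClosed (K : Set V)) {v : V}
    (h : K.quotientSeminorm v = 0) : v ∈ K := by
  have : IsClosed (K : Set V) := hK
  exact (Submodule.Quotient.mk_eq_zero K).1 (norm_eq_zero.1 h)

lemma Submodule.exists_norm_lt_of_quotientSeminorm_lt {v : V} {r : ℝ}
    (h : K.quotientSeminorm v < r) : ∃ v', v - v' ∈ K ∧ ‖v'‖ < r := by
  obtain ⟨v', hv', hlt⟩ := Submodule.Quotient.norm_mk_lt (K.mkQ v) (sub_pos.2 h)
  refine ⟨v', (Submodule.Quotient.eq K).1 hv'.symm, hlt.trans_le ?_⟩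
  change K.quotientSeminorm v + _ ≤ r
  simp

end QuotientSeminorm

/-- If signs separate the finite sets of vertices, then the graph algebra is simple: the distance to
a proper closed ideal is a submultiplicative seminorm, so by rigidity it vanishes only at zero. -/
theorem SatisfiesGraphRelations.isSimpleCStarAlgebra {V : Type*} {G : SimpleGraph V} {B : Type*}
    [CStarAlgebra B] [Nontrivial B] {u : V → B} (hu : SatisfiesGraphRelations G u)
    (hG : SignSeparating G.Adj)
    (hgen : (StarAlgebra.adjoin ℂ (Set.range u)).topologicalClosure = ⊤) :
    IsSimpleCStarAlgebra B := by
  refine ⟨inferInstance, fun I hI => ?_⟩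
  let K : Submodule ℂ B :=
    { carrier := I
      add_mem' := fun ha hb => I.add_mem ha hb
      zero_mem' := I.zero_mem
      smul_mem' := fun c x hx => by
        have := I.mul_mem_left (c • 1) x hx
        rwa [smul_mul_assoc, one_mul] at this }
  have hK : ∀ x, x ∈ K ↔ x ∈ I := fun x => Iff.rfl
  have hKc : IsClosed (K : Set B) := hI
  by_cases h1 : (1 : B) ∈ I
  · right
    refine TwoSidedIdeal.ext fun x => ⟨fun _ => trivial, fun _ => ?_⟩
    simpa using I.mul_mem_left x 1 h1
  · left
    have hmul : ∀ x y, K.quotientSeminorm (x * y) ≤ K.quotientSeminorm x * K.quotientSeminorm y := by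
      intro x y
      refine le_mul_of_forall_lt₀ fun a ha b hb => ?_
      obtain ⟨x', hx', hxa⟩ := K.exists_norm_lt_of_quotientSeminorm_lt ha
      obtain ⟨y', hy', hyb⟩ := K.exists_norm_lt_of_quotientSeminorm_lt hb
      have : x * y - x' * y' ∈ K := by
        have := I.add_mem (I.mul_mem_left x _ hy') (I.mul_mem_right _ y' hx')
        rw [hK]
        convert this using 1
        noncomm_ring
      rw [K.quotientSeminorm_congr this]
      refine (K.quotientSeminorm_le_norm _).trans ((norm_mul_le _ _).trans ?_)
      exact mul_le_mul hxa.le hyb.le (norm_nonneg _) ((norm_nonneg _).trans hxa.le)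
    refine TwoSidedIdeal.ext fun x => ⟨fun hx => ?_, fun hx => ?_⟩
    · have := hu.apply_star_mul_self hG K.quotientSeminorm hmul K.quotientSeminorm_le_norm
        (fun h => h1 (K.mem_of_quotientSeminorm_eq_zero hKc h))
        (a := x) (hgen ▸ StarSubalgebra.mem_top)
      rw [K.quotientSeminorm_eq_zero_of_mem (I.mul_mem_left _ _ hx)] at this
      have : x = 0 := by simpa using this.symm
      rw [this]
      exact (⊥ : TwoSidedIdeal B).zero_mem
    · rw [TwoSidedIdeal.mem_bot] at hx
      rw [hx]
      exact I.zero_mem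

/-! ### Nuclearity -/

section Nuclear

variable {B : Type*} [CStarAlgebra B] {C : Type*} [NonUnitalCStarAlgebra C]
  {p : Seminorm ℂ (B ⊗[ℂ] C)}

namespace IsCStarTensorNorm

lemma apply_star (hp : IsCStarTensorNorm p) (x : B ⊗[ℂ] C) : p (star x) = p x :=
  p.apply_star_of_cstar hp.mul_le hp.star_mul_self x

lemma apply_map_mulLeft (hp : IsCStarTensorNorm p) {a : B} (ha : a ∈ unitary B) (x : B ⊗[ℂ] C) :
    p (TensorProduct.map (LinearMap.mulLeft ℂ a) LinearMap.id x) = p x := by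
  rw [← sq_eq_sq₀ (apply_nonneg _ _) (apply_nonneg _ _), ← hp.star_mul_self, ← hp.star_mul_self]
  congr 1
  have key : ∀ x y : B ⊗[ℂ] C,
      star (TensorProduct.map (LinearMap.mulLeft ℂ a) LinearMap.id x) *
        TensorProduct.map (LinearMap.mulLeft ℂ a) LinearMap.id y = star x * y := by
    intro x y
    induction x using TensorProduct.induction_on with
    | zero => simp
    | add x x' hx hx' => simp only [map_add, star_add, add_mul, hx, hx']
    | tmul b c =>
      induction y using TensorProduct.induction_on with
      | zero => simp
      | add y y' hy hy' => simp only [map_add, mul_add, hy, hy']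
      | tmul b' c' =>
        simp only [TensorProduct.map_tmul, LinearMap.mulLeft_apply, LinearMap.id_apply,
          TensorProduct.star_tmul, Algebra.TensorProduct.tmul_mul_tmul, star_mul]
        rw [mul_assoc, ← mul_assoc (star a), Unitary.star_mul_self_of_mem ha, one_mul]
  exact key x x

lemma apply_map_mulRight (hp : IsCStarTensorNorm p) {a : B} (ha : a ∈ unitary B) (x : B ⊗[ℂ] C) :
    p (TensorProduct.map (LinearMap.mulRight ℂ a) LinearMap.id x) = p x := by
  rw [← hp.apply_star, ← hp.apply_star x, ← hp.apply_map_mulLeft (Unitary.star_mem ha) (star x)]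
  congr 1
  induction x using TensorProduct.induction_on with
  | zero => simp
  | add x x' hx hx' => simp only [map_add, star_add, hx, hx']
  | tmul b c => simp

variable [Nontrivial B]

lemma apply_one_tmul (hp : IsCStarTensorNorm p) (c : C) : p (1 ⊗ₜ c) = ‖c‖ := by
  let r : Seminorm ℂ C := p.comp (TensorProduct.mk ℂ B C 1)
  have hr : ∀ c, r c = p (1 ⊗ₜ c) := fun c => rfl
  rw [← hr]
  refine r.apply_eq_norm_of_cstar (fun x y => ?_) (fun x => ?_) (fun x hx => ?_) c
  · simpa [hr] using hp.mul_le (1 ⊗ₜ x) (1 ⊗ₜ y)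
  · simpa [hr] using hp.star_mul_self (1 ⊗ₜ x)
  · exact (Module.FaithfullyFlat.one_tmul_eq_zero_iff ℂ C (A := B) x).1 (hp.eq_zero _ hx)

lemma apply_unitary_tmul (hp : IsCStarTensorNorm p) {a : B} (ha : a ∈ unitary B) (c : C) :
    p (a ⊗ₜ c) = ‖c‖ := by
  rw [← hp.apply_one_tmul, ← hp.apply_map_mulLeft ha (1 ⊗ₜ c)]
  simp

/-- A C⋆-norm on the tensor product satisfies this crude form of the cross-norm property, since
elements of a unital C⋆-algebra are combinations of four unitaries. -/
lemma apply_tmul_le (hp : IsCStarTensorNorm p) (a : B) (c : C) :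
    p (a ⊗ₜ c) ≤ 2 * ‖a‖ * ‖c‖ := by
  obtain ⟨v, z, ha, hz⟩ := CStarAlgebra.exists_sum_four_unitary a
  calc p (a ⊗ₜ c) = p (∑ i, z i • ((v i : B) ⊗ₜ c)) := by
        conv_lhs => rw [ha]
        simp only [TensorProduct.sum_tmul, TensorProduct.smul_tmul']
    _ ≤ ∑ i, p (z i • ((v i : B) ⊗ₜ c)) := 
        Finset.le_sum_of_subadditive p (map_zero p).le (map_add_le_add p) _ _
    _ = ∑ i, ‖z i‖ * ‖c‖ := by
        simp only [map_smul_eq_mul, hp.apply_unitary_tmul (v _).2]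
    _ ≤ ∑ _i : Fin 4, ‖a‖ / 2 * ‖c‖ := by gcongr with i; exact hz i
    _ = 2 * ‖a‖ * ‖c‖ := by simp; ring

end IsCStarTensorNorm

variable {V : Type*} {G : SimpleGraph V} {u : V → B} {q : Seminorm ℂ (B ⊗[ℂ] C)}

/-- On the tensor product of `C` with the algebra generated by the `u x` for finitely many `x`, any
two C⋆-norms are equivalent: both are equivalent to the maximum of the norms of the coefficients,
by averaging. -/
lemma SatisfiesGraphRelations.exists_apply_le_mul [Nontrivial B] (hu : SatisfiesGraphRelations G u)
    (hG : SignSeparating G.Adj) (hp : IsCStarTensorNorm p) (hq : IsCStarTensorNorm q) (F : Finset V) :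
    ∃ K : ℝ, ∀ x ∈ Submodule.span ℂ {x : B ⊗[ℂ] C |
      ∃ a ∈ StarAlgebra.adjoin ℂ (u '' F), ∃ c, a ⊗ₜ c = x}, p x ≤ K * q x := by
  refine ⟨F.powerset.card, fun x hx => ?_⟩
  obtain ⟨c, rfl⟩ : ∃ c : Finset V → C, x = ∑ s ∈ F.powerset, finsetWord u s ⊗ₜ c s := by
    induction hx using Submodule.span_induction with
    | mem x hx =>
      obtain ⟨a, ha, c, rfl⟩ := hx
      obtain ⟨z, rfl⟩ := hu.exists_eq_sum_of_mem_adjoin ha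
      exact ⟨fun s => z s • c, by simp only [TensorProduct.sum_tmul, TensorProduct.smul_tmul]⟩
    | zero => exact ⟨0, by simp⟩
    | add x y _ _ hx hy =>
      obtain ⟨c, rfl⟩ := hx
      obtain ⟨d, rfl⟩ := hy
      exact ⟨c + d, by simp only [Pi.add_apply, TensorProduct.tmul_add, Finset.sum_add_distrib]⟩
    | smul z x _ hx =>
      obtain ⟨c, rfl⟩ := hx
      exact ⟨z • c, by simp only [Pi.smul_apply, TensorProduct.tmul_smul, Finset.smul_sum]⟩
  have bound : ∀ s ∈ F.powerset,
      p (finsetWord u s ⊗ₜ c s) ≤ q (∑ s ∈ F.powerset, finsetWord u s ⊗ₜ c s) := by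
    intro s₀ hs₀
    rw [hp.apply_unitary_tmul (hu.finsetWord_mem_unitary s₀),
      ← hq.apply_unitary_tmul (hu.finsetWord_mem_unitary s₀)]
    refine q.apply_le_apply_sum_of_separated
      (fun t : V => (TensorProduct.map (LinearMap.mulRight ℂ (u t)) LinearMap.id).comp
        (TensorProduct.map (LinearMap.mulLeft ℂ (u t)) LinearMap.id))
      (fun t v => ?_) (relSign G.Adj) (fun s => finsetWord u s ⊗ₜ c s) F.powerset hs₀
      (fun t s _ => ?_) (fun s _ hs => hG s s₀ hs)
    · rw [LinearMap.comp_apply, hq.apply_map_mulRight (hu.mem_unitary t),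
        hq.apply_map_mulLeft (hu.mem_unitary t)]
    · simp only [LinearMap.comp_apply, TensorProduct.map_tmul, LinearMap.mulLeft_apply,
        LinearMap.mulRight_apply, LinearMap.id_apply, hu.mul_finsetWord_mul]
      rcases Int.units_eq_one_or (relSign G.Adj t s) with h | h <;> simp [h, TensorProduct.neg_tmul]
  calc p (∑ s ∈ F.powerset, finsetWord u s ⊗ₜ c s)
      ≤ ∑ s ∈ F.powerset, p (finsetWord u s ⊗ₜ c s) := 
        Finset.le_sum_of_subadditive p (map_zero p).le (map_add_le_add p) _ _
    _ ≤ ∑ _s ∈ F.powerset, q (∑ s ∈ F.powerset, finsetWord u s ⊗ₜ c s) :=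
        Finset.sum_le_sum bound
    _ = _ := by rw [Finset.sum_const, nsmul_eq_mul]

lemma SatisfiesGraphRelations.tensorNorm_le [Nontrivial B] (hu : SatisfiesGraphRelations G u)
    (hG : SignSeparating G.Adj)
    (hgen : (StarAlgebra.adjoin ℂ (Set.range u)).topologicalClosure = ⊤)
    (hp : IsCStarTensorNorm p) (hq : IsCStarTensorNorm q) (x : B ⊗[ℂ] C) : p x ≤ q x := by
  classical
  let M : Finset V → Submodule ℂ (B ⊗[ℂ] C) := fun F => Submodule.span ℂ {x : B ⊗[ℂ] C |
      ∃ a ∈ StarAlgebra.adjoin ℂ (u '' F), ∃ c, a ⊗ₜ c = x}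
  have hM : ∀ F F', F ⊆ F' → M F ≤ M F' := fun F F' h => Submodule.span_mono <| by
    rintro _ ⟨a, ha, c, rfl⟩
    exact ⟨a, StarAlgebra.adjoin_mono (Set.image_mono (Finset.coe_subset.2 h)) ha, c, rfl⟩
  have hmul : ∀ F, ∀ x ∈ M F, ∀ y ∈ M F, x * y ∈ M F := by
    intro F x hx y hy
    induction hx using Submodule.span_induction with
    | zero => simp
    | add x x' _ _ hx hx' => rw [add_mul]; exact (M F).add_mem hx hx'
    | smul z x _ hx => rw [smul_mul_assoc]; exact (M F).smul_mem z hx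
    | mem x hx =>
      obtain ⟨a, ha, c, rfl⟩ := hx
      induction hy using Submodule.span_induction with
      | zero => simp
      | add x x' _ _ hx hx' => rw [mul_add]; exact (M F).add_mem hx hx'
      | smul z x _ hx => rw [mul_smul_comm]; exact (M F).smul_mem z hx
      | mem y hy =>
        obtain ⟨a', ha', c', rfl⟩ := hy
        rw [Algebra.TensorProduct.tmul_mul_tmul]
        exact Submodule.subset_span ⟨_, mul_mem ha ha', _, rfl⟩
  have hstar : ∀ F, ∀ x ∈ M F, star x ∈ M F := by
    intro F x hx
    induction hx using Submodule.span_induction with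
    | zero => simp
    | add x x' _ _ hx hx' => rw [star_add]; exact (M F).add_mem hx hx'
    | smul z x _ hx => rw [star_smul]; exact (M F).smul_mem _ hx
    | mem x hx =>
      obtain ⟨a, ha, c, rfl⟩ := hx
      rw [TensorProduct.star_tmul]
      exact Submodule.subset_span ⟨_, star_mem ha, _, rfl⟩
  have dense : ∀ x : B ⊗[ℂ] C, ∀ ε > 0, ∃ F, ∃ y ∈ M F, p (x - y) ≤ ε ∧ q (x - y) ≤ ε := by
    intro x
    induction x using TensorProduct.induction_on with
    | zero => exact fun ε hε => ⟨∅, 0, zero_mem _, by simp [hε.le], by simp [hε.le]⟩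
    | add x x' hx hx' =>
      intro ε hε
      obtain ⟨F, y, hy, hyp, hyq⟩ := hx (ε / 2) (half_pos hε)
      obtain ⟨F', y', hy', hyp', hyq'⟩ := hx' (ε / 2) (half_pos hε)
      refine ⟨F ∪ F', y + y', add_mem (hM _ _ Finset.subset_union_left hy)
        (hM _ _ Finset.subset_union_right hy'), ?_, ?_⟩ <;> rw [add_sub_add_comm]
      · exact (map_add_le_add p _ _).trans (by linarith)
      · exact (map_add_le_add q _ _).trans (by linarith)
    | tmul b c =>
      intro ε hε
      have hb : b ∈ closure (StarAlgebra.adjoin ℂ (Set.range u) : Set B) := by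
        rw [← StarSubalgebra.topologicalClosure_coe, hgen]
        trivial
      obtain ⟨a, ha, hab⟩ := Metric.mem_closure_iff.1 hb (ε / (2 * (‖c‖ + 1))) (by positivity)
      obtain ⟨F, hF⟩ := exists_mem_adjoin_image ha
      have hε' : 2 * ‖b - a‖ * ‖c‖ ≤ ε := by
        rw [dist_eq_norm, lt_div_iff₀ (by positivity)] at hab
        nlinarith [norm_nonneg (b - a), norm_nonneg c]
      refine ⟨F, a ⊗ₜ c, Submodule.subset_span ⟨a, hF, c, rfl⟩, ?_, ?_⟩ <;>
        rw [← TensorProduct.sub_tmul]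
      · exact (hp.apply_tmul_le _ _).trans hε'
      · exact (hq.apply_tmul_le _ _).trans hε'
  refine le_of_forall_pos_le_add fun ε hε => ?_
  obtain ⟨F, y, hy, hyp, hyq⟩ := dense x (ε / 2) (half_pos hε)
  obtain ⟨K, hK⟩ := hu.exists_apply_le_mul hG hp hq F
  have h1 : p y ≤ q y := Seminorm.apply_le_apply_of_cstar hp.star_mul_self hq.star_mul_self
    (M := (M F : Set (B ⊗[ℂ] C))) (hmul F) (hstar F) hK hy
  have h2 : p x ≤ p (x - y) + p y := by simpa using map_add_le_add p (x - y) y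
  have h3 : q y ≤ q (x - y) + q x := by
    have := map_sub_le_add q x (x - y)
    rw [sub_sub_cancel] at this
    linarith
  linarith

/-- If signs separate the finite sets of vertices, then the graph algebra is nuclear. -/
theorem SatisfiesGraphRelations.isNuclearCStarAlgebra [Nontrivial B]
    (hu : SatisfiesGraphRelations G u) (hG : SignSeparating G.Adj)
    (hgen : (StarAlgebra.adjoin ℂ (Set.range u)).topologicalClosure = ⊤) :
    IsNuclearCStarAlgebra.{w} B := fun _ _ _ _ hp hq =>
  Seminorm.ext fun x =>
    le_antisymm (hu.tensorNorm_le hG hgen hp hq x) (hu.tensorNorm_le hG hgen hq hp x)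

end Nuclear

/-! ### The representations on `ℓ²` of the finite subsets of a set -/

section SignedPerm

variable {ι : Type*}

/-- The isometry of `ℓ²` that composes with the permutation `σ` and multiplies by the signs `ε`. -/
noncomputable def signedPermIsometry (σ : Equiv.Perm ι) (ε : ι → ℤˣ) :
    lp (fun _ : ι => ℂ) 2 →ₗᵢ[ℂ] lp (fun _ : ι => ℂ) 2 where
  toFun f := ⟨fun i => ε i • f (σ i), by
    have h := (memℓp_gen_iff (by simp : 0 < (2 : ENNReal).toReal)).1 f.2
    refine memℓp_gen ((σ.summable_iff.2 h).congr fun i => ?_)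
    rcases Int.units_eq_one_or (ε i) with h | h <;> simp [h]⟩
  map_add' f g := lp.ext (funext fun i => smul_add _ _ _)
  map_smul' c f := lp.ext (funext fun i => smul_comm (ε i) c (f (σ i)))
  norm_map' f := by
    have h2 : 0 < (2 : ENNReal).toReal := by simp
    rw [lp.norm_eq_tsum_rpow h2, lp.norm_eq_tsum_rpow h2,
      ← σ.tsum_eq fun i => ‖f i‖ ^ (2 : ENNReal).toReal]
    congr 1
    refine tsum_congr fun i => ?_
    rcases Int.units_eq_one_or (ε i) with h | h <;> simp [h]

/-- The bounded operator underlying `signedPermIsometry`. -/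
noncomputable def signedPerm (σ : Equiv.Perm ι) (ε : ι → ℤˣ) :
    lp (fun _ : ι => ℂ) 2 →L[ℂ] lp (fun _ : ι => ℂ) 2 :=
  (signedPermIsometry σ ε).toContinuousLinearMap

@[simp]
lemma signedPerm_apply (σ : Equiv.Perm ι) (ε : ι → ℤˣ) (f : lp (fun _ : ι => ℂ) 2) (i : ι) :
    signedPerm σ ε f i = ε i • f (σ i) := rfl

lemma norm_signedPerm_apply (σ : Equiv.Perm ι) (ε : ι → ℤˣ) (f : lp (fun _ : ι => ℂ) 2) :
    ‖signedPerm σ ε f‖ = ‖f‖ :=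
  (signedPermIsometry σ ε).norm_map f

lemma signedPerm_mem_unitary {σ : Equiv.Perm ι} {ε : ι → ℤˣ}
    (h : signedPerm σ ε * signedPerm σ ε = 1) : signedPerm σ ε ∈ unitary _ := by
  have h1 : star (signedPerm σ ε) * signedPerm σ ε = 1 :=
    (ContinuousLinearMap.norm_map_iff_adjoint_comp_self _).1 (norm_signedPerm_apply σ ε)
  have h2 : star (signedPerm σ ε) = signedPerm σ ε := by
    rw [← mul_one (star _), ← h, ← mul_assoc, h1, one_mul]
  exact Unitary.mem_iff.2 ⟨h1, by rw [h2, h]⟩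

end SignedPerm

open Classical in
/-- The translation `s ↦ s ∆ {x}` of finite sets. -/
noncomputable def toggle {X : Type*} (x : X) : Equiv.Perm (Finset X) :=
  Function.Involutive.toPerm (fun s => symmDiff s {x}) fun _ => symmDiff_symmDiff_cancel_right _ _

open Classical in
lemma toggle_apply {X : Type*} (x : X) (s : Finset X) : toggle x s = symmDiff s {x} := rfl

@[simp]
lemma toggle_toggle {X : Type*} (x : X) (s : Finset X) : toggle x (toggle x s) = s := by
  classical
  simp only [toggle_apply, symmDiff_symmDiff_cancel_right]

lemma toggle_comm {X : Type*} (x y : X) (s : Finset X) :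
    toggle x (toggle y s) = toggle y (toggle x s) := by
  classical
  simp only [toggle_apply, symmDiff_right_comm]

open Classical in
lemma relSign_toggle {Z X : Type*} (R : Z → X → Prop) (z : Z) (x : X) (s : Finset X) :
    relSign R z (toggle x s) = (if R z x then -1 else 1) * relSign R z s := by
  have key : ∀ s : Finset X, x ∉ s →
      relSign R z (toggle x s) = (if R z x then -1 else 1) * relSign R z s := fun s hx => by
    have : toggle x s = insert x s := by
      ext y
      simp only [toggle_apply, Finset.mem_symmDiff, Finset.mem_singleton, Finset.mem_insert]
      grind
    rw [this, relSign, Finset.prod_insert hx, relSign]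
  by_cases hx : x ∈ s
  · have hx' : x ∉ toggle x s := by simp [toggle_apply, Finset.mem_symmDiff, hx]
    have := key _ hx'
    rw [toggle_toggle] at this
    rw [this]
    split_ifs <;> simp
  · exact key s hx

section IncidenceRep

variable {Z X : Type*} (R : Z → X → Prop)

/-- The operator of translation by `{x}` on `ℓ²(Finset X)`. -/
noncomputable def toggleOp (x : X) :
    lp (fun _ : Finset X => ℂ) 2 →L[ℂ] lp (fun _ : Finset X => ℂ) 2 :=
  signedPerm (toggle x) 1

/-- The operator of multiplication by the sign function of `z` on `ℓ²(Finset X)`. -/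
noncomputable def signOp (z : Z) :
    lp (fun _ : Finset X => ℂ) 2 →L[ℂ] lp (fun _ : Finset X => ℂ) 2 :=
  signedPerm 1 (relSign R z)

lemma toggleOp_mul_comm (x y : X) : toggleOp x * toggleOp y = toggleOp y * toggleOp x := by
  ext f s
  simp [toggleOp, toggle_comm]

lemma toggleOp_mul_self (x : X) : toggleOp x * toggleOp x = 1 := by
  ext f s
  simp [toggleOp]

lemma signOp_mul_comm (y z : Z) : signOp R y * signOp R z = signOp R z * signOp R y := by
  ext f s
  simp [signOp, smul_smul, mul_comm]

lemma signOp_mul_self (z : Z) : signOp R z * signOp R z = 1 := by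
  ext f s
  simp [signOp, smul_smul]

lemma toggleOp_mul_signOp_of_not {z : Z} {x : X} (h : ¬ R z x) :
    toggleOp x * signOp R z = signOp R z * toggleOp x := by
  ext f s
  simp [toggleOp, signOp, relSign_toggle, h]

lemma toggleOp_mul_signOp {z : Z} {x : X} (h : R z x) :
    toggleOp x * signOp R z = -(signOp R z * toggleOp x) := by
  ext f s
  simp [toggleOp, signOp, relSign_toggle, h]

lemma toggleOp_mem_unitary (x : X) : toggleOp x ∈ unitary _ :=
  signedPerm_mem_unitary (toggleOp_mul_self x)

lemma signOp_mem_unitary (z : Z) : signOp R z ∈ unitary _ :=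
  signedPerm_mem_unitary (signOp_mul_self R z)

/-- The operators `toggleOp x` and `signOp R z` have no common invariant closed subspaces: the signs
project a vector to its coordinates, and the translations permute the basis vectors
transitively. -/
lemma eq_bot_or_eq_top_of_invariant (hR : SignSeparating R)
    (K : Submodule ℂ (lp (fun _ : Finset X => ℂ) 2)) (hK : IsClosed (K : Set (lp (fun _ : Finset X => ℂ) 2)))
    (hT : ∀ x, ∀ f ∈ K, toggleOp x f ∈ K) (hM : ∀ z, ∀ f ∈ K, signOp R z f ∈ K) :
    K = ⊥ ∨ K = ⊤ := by
  classical
  by_cases hbot : K = ⊥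
  · exact Or.inl hbot
  right
  obtain ⟨f, hf, hf0⟩ := K.ne_bot_iff.1 hbot
  obtain ⟨s₀, hs₀⟩ : ∃ s, f s ≠ 0 := by
    by_contra! h
    exact hf0 (lp.ext (funext h))
  have hsum : ∀ g : lp (fun _ : Finset X => ℂ) 2,
      HasSum (fun s => lp.single 2 s (g s)) g := lp.hasSum_single ENNReal.ofNat_ne_top
  have hMp : ∀ z g, K.quotientSeminorm (signOp R z g) ≤ K.quotientSeminorm g := fun z g => by
    refine le_of_forall_gt fun r hr => ?_
    obtain ⟨g', hg', hlt⟩ := K.exists_norm_lt_of_quotientSeminorm_lt hr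
    rw [K.quotientSeminorm_congr (v' := signOp R z g') (by rw [← map_sub]; exact hM z _ hg')]
    refine (K.quotientSeminorm_le_norm _).trans_lt ?_
    rwa [signOp, norm_signedPerm_apply]
  -- The averages of `f` over the signs lie in `K`; for a large finite set `S` of coordinates, they come
  -- as close to the coordinate of `f` at `s₀` as the part of `f` outside `S` is small.
  have hcoord : lp.single 2 s₀ (f s₀) ∈ K := by
    refine K.mem_of_quotientSeminorm_eq_zero hK (le_antisymm ?_ (apply_nonneg _ _))
    refine ge_of_tendsto (tendsto_iff_norm_sub_tendsto_zero.1 (hsum f)) ?_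
    filter_upwards [Filter.eventually_ge_atTop {s₀}] with S hS
    have h1 := K.quotientSeminorm.apply_le_apply_sum_of_separated
      (fun z => (signOp R z : lp (fun _ : Finset X => ℂ) 2 →ₗ[ℂ] lp (fun _ : Finset X => ℂ) 2)) hMp
      (relSign R) (fun s => lp.single 2 s (f s)) S (Finset.singleton_subset_iff.1 hS)
      (fun z s _ => by
        ext t
        simp only [signOp, ContinuousLinearMap.coe_coe, signedPerm_apply, Equiv.Perm.one_apply]
        by_cases hts : t = s
        · subst hts
          rcases Int.units_eq_one_or (relSign R z t) with h | h <;> simp [h]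
        · rcases Int.units_eq_one_or (relSign R z s) with h | h <;> simp [h, hts])
      (fun s _ hs => hR s s₀ hs)
    refine h1.trans ?_
    rw [K.quotientSeminorm_congr (v' := (∑ s ∈ S, lp.single 2 s (f s)) - f)
      (by rwa [sub_sub_cancel])]
    exact K.quotientSeminorm_le_norm _
  have hone : lp.single 2 s₀ (1 : ℂ) ∈ K := by
    have := K.smul_mem (f s₀)⁻¹ hcoord
    rwa [← lp.single_smul, smul_eq_mul, inv_mul_cancel₀ hs₀] at this
  have htoggle : ∀ x s, lp.single 2 s (1 : ℂ) ∈ K → lp.single 2 (toggle x s) (1 : ℂ) ∈ K := by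
    intro x s hs
    convert hT x _ hs using 1
    ext t
    have : toggle x t = s ↔ t = toggle x s :=
      ⟨fun h => by rw [← h, toggle_toggle], fun h => by rw [h, toggle_toggle]⟩
    simp [toggleOp, Pi.single_apply, this]
  have htranslate : ∀ t s, lp.single 2 s (1 : ℂ) ∈ K → lp.single 2 (symmDiff s t) (1 : ℂ) ∈ K := by
    intro t
    induction t using Finset.induction_on with
    | empty => intro s hs; rwa [← Finset.bot_eq_empty, symmDiff_bot]
    | insert x t hx ih =>
      intro s hs
      have : insert x t = symmDiff {x} t := by
        ext y
        simp only [Finset.mem_symmDiff, Finset.mem_singleton, Finset.mem_insert]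
        grind
      rw [this, ← symmDiff_assoc]
      exact ih _ (htoggle x s hs)
  refine Submodule.eq_top_iff'.2 fun g => hK.mem_of_tendsto (hsum g) (Filter.Eventually.of_forall
    fun S => K.sum_mem fun s _ => ?_)
  have := K.smul_mem (g s) (htranslate (symmDiff s₀ s) s₀ hone)
  rwa [symmDiff_symmDiff_cancel_left, ← lp.single_smul, smul_eq_mul, mul_one] at this

end IncidenceRep

/-! ### Separability of `ℓ²` -/

lemma separableSpace_lp_two {ι : Type*} [Countable ι] :
    TopologicalSpace.SeparableSpace (lp (fun _ : ι => ℂ) 2) := by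
  classical
  rw [← TopologicalSpace.isSeparable_univ_iff]
  have h := ((Set.countable_range fun i : ι =>
    (lp.single 2 i (1 : ℂ) : lp (fun _ : ι => ℂ) 2)).isSeparable.span (R := ℂ)).closure
  refine h.mono fun f _ => mem_closure_of_tendsto (lp.hasSum_single ENNReal.ofNat_ne_top f)
    (Filter.Eventually.of_forall fun S => Submodule.sum_mem _ fun i _ => ?_)
  have : lp.single 2 i (f i) = f i • (lp.single 2 i (1 : ℂ) : lp (fun _ : ι => ℂ) 2) := by
    rw [← lp.single_smul, smul_eq_mul, mul_one]
  rw [this]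
  exact Submodule.smul_mem _ _ (Submodule.subset_span ⟨i, rfl⟩)

lemma not_separableSpace_lp_two {ι : Type*} [Uncountable ι] :
    ¬ TopologicalSpace.SeparableSpace (lp (fun _ : ι => ℂ) 2) := by
  classical
  intro _
  refine not_countable (α := ι) (Pairwise.countable_of_isOpen_disjoint
    (s := fun i => Metric.ball (lp.single 2 i (1 : ℂ) : lp (fun _ : ι => ℂ) 2) (1 / 2))
    (fun i j hij => Metric.ball_disjoint_ball ?_) (fun _ => Metric.isOpen_ball)
    fun i => ⟨_, Metric.mem_ball_self (by norm_num)⟩)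
  have := lp.norm_apply_le_norm (by simp : (2 : ENNReal) ≠ 0)
    ((lp.single 2 i (1 : ℂ) : lp (fun _ : ι => ℂ) 2) - lp.single 2 j 1) i
  rw [dist_eq_norm]
  norm_num
  simpa [hij] using this

/-! ### Dense and independent families of sets -/

/-- If `i` is the only element of `s ∪ s'` that `z` is related to, then `z` tells apart `s` and
`s'`, provided that `i` lies in only one of them. -/
lemma relSign_ne_of_isolated {Z X : Type*} {R : Z → X → Prop} {z : Z} {i : X} {s s' : Finset X}
    (hi : i ∈ s) (hi' : i ∉ s') (h : ∀ j, j ∈ s ∨ j ∈ s' → (R z j ↔ j = i)) :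
    relSign R z s ≠ relSign R z s' := by
  classical
  have h1 : relSign R z s = -1 := by
    rw [relSign, Finset.prod_eq_single_of_mem i hi fun j hj hji => if_neg (by rwa [h j (.inl hj)])]
    exact if_pos ((h i (.inl hi)).2 rfl)
  have h2 : relSign R z s' = 1 := Finset.prod_eq_one fun j hj =>
    if_neg fun hr => hi' ((h j (.inr hj)).1 hr ▸ hj)
  rw [h1, h2]
  decide

lemma signSeparating_of_isolating {Z X : Type*} {R : Z → X → Prop}
    (h : ∀ (S : Finset X), ∀ i ∈ S, ∃ z, ∀ j ∈ S, (R z j ↔ j = i)) : SignSeparating R := by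
  classical
  intro s s' hne
  obtain ⟨i, hi⟩ : ∃ i, ¬ (i ∈ s ↔ i ∈ s') := by
    by_contra! hall
    exact hne (Finset.ext hall)
  by_cases his : i ∈ s
  · have his' : i ∉ s' := fun h' => hi ⟨fun _ => h', fun _ => his⟩
    obtain ⟨z, hz⟩ := h (s ∪ s') i (Finset.mem_union_left _ his)
    exact ⟨z, relSign_ne_of_isolated his his' fun j hj => hz j (Finset.mem_union.2 hj)⟩
  · have his' : i ∈ s' := by
      by_contra h'
      exact hi ⟨fun h => absurd h his, fun h => absurd h h'⟩
    obtain ⟨z, hz⟩ := h (s ∪ s') i (Finset.mem_union_right _ his')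
    exact ⟨z, (relSign_ne_of_isolated his' his
      fun j hj => hz j (Finset.mem_union.2 hj.symm)).symm⟩

section Families

variable {Y : Type*} {𝔸 : Set (Set Y)}

lemma DenseFamily.signSeparating (h : DenseFamily 𝔸) :
    SignSeparating fun (x : 𝔸) (i : Y) => i ∈ x.1 := by
  classical
  refine signSeparating_of_isolating fun S i _ => ?_
  let U : Set (Y → Bool) := {f | ∀ j ∈ S, f j = decide (j = i)}
  have hU : IsOpen U := by
    have : U = ⋂ j ∈ S, (fun f : Y → Bool => f j) ⁻¹' {decide (j = i)} := by ext; simp [U]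
    rw [this]
    exact isOpen_biInter_finset fun j _ => (isOpen_discrete _).preimage (continuous_apply j)
  obtain ⟨f, hfU, hf⟩ := h.inter_open_nonempty U hU ⟨fun j => decide (j = i), fun _ _ => rfl⟩
  exact ⟨⟨_, hf⟩, fun j hj => by simp [hfU j hj]⟩

lemma IndependentFamily.signSeparating (h : IndependentFamily 𝔸) :
    SignSeparating fun (i : Y) (x : 𝔸) => i ∈ x.1 := by
  classical
  refine signSeparating_of_isolating fun S x hx => ?_
  obtain ⟨i, hi, hi'⟩ := h {x.1} ((S.erase x).image Subtype.val)
    (by simp) (by simp) (Finset.singleton_nonempty _) (by simp)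
  refine ⟨i, fun y hy => ⟨fun hiy => ?_, ?_⟩⟩
  · by_contra hyx
    exact hi' (Set.mem_biUnion (Finset.mem_image_of_mem _ (Finset.mem_erase.2 ⟨hyx, hy⟩)) hiy)
  · rintro rfl
    simpa using hi

lemma relSign_incidenceGraph_inl (i : Y) (s : Finset (Y ⊕ 𝔸)) :
    relSign (incidenceGraph 𝔸).Adj (Sum.inl i) s =
      relSign (fun (i : Y) (x : 𝔸) => i ∈ x.1) i s.toRight := by
  classical
  conv_lhs => rw [relSign, ← Finset.toLeft_disjSum_toRight (u := s)]
  rw [Finset.prod_disjSum, Finset.prod_eq_one (s := s.toLeft), one_mul]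
  · simp only [relSign, incidenceGraph]
    congr!
  · simp [incidenceGraph]

lemma relSign_incidenceGraph_inr (x : 𝔸) (s : Finset (Y ⊕ 𝔸)) :
    relSign (incidenceGraph 𝔸).Adj (Sum.inr x) s =
      relSign (fun (x : 𝔸) (i : Y) => i ∈ x.1) x s.toLeft := by
  classical
  conv_lhs => rw [relSign, ← Finset.toLeft_disjSum_toRight (u := s)]
  rw [Finset.prod_disjSum, Finset.prod_eq_one (s := s.toRight), mul_one]
  · simp only [relSign, incidenceGraph]
    congr!
  · simp [incidenceGraph]

lemma signSeparating_incidenceGraph (hd : DenseFamily 𝔸) (hi : IndependentFamily 𝔸) :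
    SignSeparating (incidenceGraph 𝔸).Adj := by
  intro s s' hne
  by_cases hl : s.toLeft = s'.toLeft
  · have hr : s.toRight ≠ s'.toRight := fun hr => hne <| by
      rw [← Finset.toLeft_disjSum_toRight (u := s), hl, hr, Finset.toLeft_disjSum_toRight]
    obtain ⟨i, h⟩ := hi.signSeparating _ _ hr
    exact ⟨Sum.inl i, by rwa [relSign_incidenceGraph_inl, relSign_incidenceGraph_inl]⟩
  · obtain ⟨x, h⟩ := hd.signSeparating _ _ hl
    exact ⟨Sum.inr x, by rwa [relSign_incidenceGraph_inr, relSign_incidenceGraph_inr]⟩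

lemma satisfiesGraphRelations_toggle_sign :
    SatisfiesGraphRelations (incidenceGraph 𝔸)
      (Sum.elim toggleOp (signOp fun (x : 𝔸) (i : Y) => i ∈ x.1)) where
  mem_unitary := by
    rintro (i | x)
    exacts [toggleOp_mem_unitary i, signOp_mem_unitary _ x]
  sq_eq_one := by
    rintro (i | x) <;> rw [sq]
    exacts [toggleOp_mul_self i, signOp_mul_self _ x]
  commute := by
    rintro (i | x) (j | y) h
    exacts [toggleOp_mul_comm i j, toggleOp_mul_signOp_of_not _ h,
      (toggleOp_mul_signOp_of_not (fun (x : 𝔸) (i : Y) => i ∈ x.1) h).symm, signOp_mul_comm _ x y]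
  anticommute := by
    rintro (i | x) (j | y) h
    exacts [h.elim, toggleOp_mul_signOp _ h,
      (neg_eq_iff_eq_neg.2 (toggleOp_mul_signOp
        (fun (x : 𝔸) (i : Y) => i ∈ x.1) h)).symm, h.elim]

lemma satisfiesGraphRelations_sign_toggle :
    SatisfiesGraphRelations (incidenceGraph 𝔸)
      (Sum.elim (signOp fun (i : Y) (x : 𝔸) => i ∈ x.1) toggleOp) where
  mem_unitary := by
    rintro (i | x)
    exacts [signOp_mem_unitary _ i, toggleOp_mem_unitary x]
  sq_eq_one := by
    rintro (i | x) <;> rw [sq]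
    exacts [signOp_mul_self _ i, toggleOp_mul_self x]
  commute := by
    rintro (i | x) (j | y) h
    exacts [signOp_mul_comm _ i j, (toggleOp_mul_signOp_of_not (fun (i : Y) (x : 𝔸) => i ∈ x.1) h).symm,
      toggleOp_mul_signOp_of_not _ h, toggleOp_mul_comm x y]
  anticommute := by
    rintro (i | x) (j | y) h
    exacts [h.elim, (neg_eq_iff_eq_neg.2 (toggleOp_mul_signOp
        (fun (i : Y) (x : 𝔸) => i ∈ x.1) h)).symm,
      toggleOp_mul_signOp _ h, h.elim]

end Families

/-! ### Existence of a dense independent family -/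

/-- The trace of `r` on `{0, …, k - 1}`. -/
noncomputable def initialTrace (k : ℕ) (r : Set ℕ) : Finset ℕ := by
  classical exact (Finset.range k).filter (· ∈ r)

lemma eventually_initialTrace_ne {r r' : Set ℕ} (h : r ≠ r') :
    ∀ᶠ k in Filter.atTop, initialTrace k r ≠ initialTrace k r' := by
  obtain ⟨n, hn⟩ : ∃ n, ¬ (n ∈ r ↔ n ∈ r') := by
    by_contra! hall
    exact h (Set.ext hall)
  filter_upwards [Filter.eventually_gt_atTop n] with k hk heq
  have := Finset.ext_iff.1 heq n
  simp only [initialTrace, Finset.mem_filter, Finset.mem_range, hk, true_and] at this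
  exact hn this

/-- The classical independent family on the countable set of pairs `(k, S)`, where `S` is a finite
set of finite sets: the member indexed by `r` consists of the `(k, S)` such that `S` contains
the trace of `r` on `{0, …, k - 1}`. -/
def traceFamily (r : Set ℕ) : Set ℕ :=
  {n | initialTrace ((Denumerable.eqv (ℕ × Finset (Finset ℕ))).symm n).1 r ∈
    ((Denumerable.eqv (ℕ × Finset (Finset ℕ))).symm n).2}

lemma infinite_traceFamily {F F' : Finset (Set ℕ)} (h : Disjoint F F') :
    {n | (∀ r ∈ F, n ∈ traceFamily r) ∧ ∀ r ∈ F', n ∉ traceFamily r}.Infinite := by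
  classical
  have hev : ∀ᶠ k in Filter.atTop, ∀ r ∈ F, ∀ r' ∈ F', initialTrace k r ≠ initialTrace k r' :=
    (Filter.eventually_all_finset F).2 fun r hr => (Filter.eventually_all_finset F').2 fun r' hr' =>
      eventually_initialTrace_ne fun heq => Finset.disjoint_left.1 h hr (heq ▸ hr')
  obtain ⟨k₀, hk₀⟩ := Filter.eventually_atTop.1 hev
  refine Set.infinite_of_injective_forall_mem
    (f := fun j : ℕ => Denumerable.eqv (ℕ × Finset (Finset ℕ))
      (k₀ + j, F.image (initialTrace (k₀ + j)))) (fun i j hij => ?_) fun j => ⟨?_, ?_⟩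
  · have := congrArg Prod.fst ((Denumerable.eqv _).injective hij)
    simpa using this
  · intro r hr
    simp only [traceFamily, Set.mem_ofPred_eq, Equiv.symm_apply_apply]
    exact Finset.mem_image_of_mem _ hr
  · intro r' hr'
    simp only [traceFamily, Set.mem_ofPred_eq, Equiv.symm_apply_apply, Finset.mem_image, not_exists,
      not_and]
    exact fun r hr => hk₀ _ (Nat.le_add_right _ _) r hr r' hr'

/-- A dense independent family of cardinality `2 ^ ℵ₀`. In `traceFamily`, the Boolean combinations
are even infinite, so that it stays independent if each member is changed at finitely many places;
the changes prescribe all finite patterns, which makes the family dense. -/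
theorem exists_denseFamily_independentFamily :
    ∃ 𝔸 : Set (Set ℕ), DenseFamily 𝔸 ∧ IndependentFamily 𝔸 ∧
      Cardinal.mk 𝔸 = Cardinal.continuum := by
  classical
  obtain ⟨g, hg⟩ : ∃ g : Set ℕ → Finset ℕ × Finset ℕ, Function.Surjective g :=
    ⟨Function.invFun fun p => {Encodable.encode p}, Function.invFun_surjective fun p q h =>
      Encodable.encode_injective (Set.singleton_injective h)⟩
  let X : Set ℕ → Set ℕ := fun r => (traceFamily r \ (g r).1) ∪ (g r).2
  have hX : ∀ F F' : Finset (Set ℕ), Disjoint F F' →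
      ∃ n, (∀ r ∈ F, n ∈ X r) ∧ ∀ r ∈ F', n ∉ X r := by
    intro F F' h
    obtain ⟨n, ⟨hn, hn'⟩, hnot⟩ := (infinite_traceFamily h).exists_notMem_finset
      ((F ∪ F').biUnion fun r => (g r).1 ∪ (g r).2)
    simp only [Finset.mem_biUnion, Finset.mem_union, not_exists, not_and, not_or] at hnot
    refine ⟨n, fun r hr => Or.inl ⟨hn r hr, (hnot r (.inl hr)).1⟩, fun r hr => ?_⟩
    rintro (hr' | hr')
    · exact hn' r hr hr'.1
    · exact (hnot r (.inr hr)).2 hr'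
  have hXi : Function.Injective X := by
    intro r r' heq
    by_contra hne
    obtain ⟨n, hn, hn'⟩ := hX {r} {r'} (by simpa using hne)
    exact hn' r' (by simp) (heq ▸ hn r (by simp))
  refine ⟨Set.range X, ?_, ?_, ?_⟩
  · refine dense_iff_inter_open.2 fun U hU ⟨f, hf⟩ => ?_
    obtain ⟨I, v, hv, hsub⟩ := isOpen_pi_iff.1 hU f hf
    obtain ⟨r, hr⟩ := hg (I, I.filter fun n => f n = true)
    refine ⟨fun n => decide (n ∈ X r), hsub fun n hn => ?_, r, by simp⟩
    have hn' : n ∈ I := hn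
    have : decide (n ∈ X r) = f n := by
      have : n ∈ X r ↔ f n = true := by simp [X, hr, hn']
      simp [this]
    rw [this]
    exact (hv n hn').2
  · intro F G hF hG _ hd
    obtain ⟨n, hn, hn'⟩ := hX (F.preimage X hXi.injOn) (G.preimage X hXi.injOn)
      (Finset.disjoint_left.2 fun r hr hr' => Finset.disjoint_left.1 hd
        (Finset.mem_preimage.1 hr) (Finset.mem_preimage.1 hr'))
    refine ⟨n, Set.mem_iInter₂.2 fun x hx => ?_, fun hmem => ?_⟩
    · obtain ⟨r, rfl⟩ := hF hx
      exact hn r (Finset.mem_preimage.2 hx)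
    · obtain ⟨x, hx, hnx⟩ := Set.mem_iUnion₂.1 hmem
      obtain ⟨r, rfl⟩ := hG hx
      exact hn' r (Finset.mem_preimage.2 hx) hnx
  · rw [Cardinal.mk_range_eq X hXi, Cardinal.mk_set, Cardinal.mk_nat, Cardinal.two_power_aleph0]

/-! ### The algebra and its representations -/

lemma topologicalClosure_adjoin_range_codRestrict {V E : Type*} [CStarAlgebra E] (w : V → E)
    (hw : ∀ x, w x ∈ (StarAlgebra.adjoin ℂ (Set.range w)).topologicalClosure) :
    (StarAlgebra.adjoin ℂ (Set.range fun x =>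
      (⟨w x, hw x⟩ : (StarAlgebra.adjoin ℂ (Set.range w)).topologicalClosure))).topologicalClosure
      = ⊤ := by
  set S := (StarAlgebra.adjoin ℂ (Set.range w)).topologicalClosure with hS
  refine StarSubalgebra.eq_top_iff.2 fun b => ?_
  rw [← SetLike.mem_coe, StarSubalgebra.topologicalClosure_coe, closure_subtype]
  have hmap := StarAlgHom.map_adjoin S.subtype (Set.range fun x => (⟨w x, hw x⟩ : S))
  have himage : S.subtype '' (Set.range fun x => (⟨w x, hw x⟩ : S)) = Set.range w := by
    rw [← Set.range_comp]
    rfl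
  rw [himage] at hmap
  have := congrArg (fun T : StarSubalgebra ℂ E => (T : Set E)) hmap
  simp only [StarSubalgebra.coe_map, StarSubalgebra.coe_subtype] at this
  rw [this]
  exact b.2

lemma SatisfiesGraphRelations.codRestrict {V E : Type*} {G : SimpleGraph V} [CStarAlgebra E]
    {w : V → E} (hw : SatisfiesGraphRelations G w) (S : StarSubalgebra ℂ E)
    [IsClosed (S : Set E)] (hS : ∀ x, w x ∈ S) :
    SatisfiesGraphRelations G fun x => (⟨w x, hS x⟩ : S) where
  mem_unitary x := Unitary.mem_iff.2
    ⟨Subtype.ext (Unitary.star_mul_self_of_mem (hw.mem_unitary x)),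
      Subtype.ext (Unitary.mul_star_self_of_mem (hw.mem_unitary x))⟩
  sq_eq_one x := Subtype.ext (hw.sq_eq_one x)
  commute x y h := Subtype.ext (hw.commute x y h)
  anticommute x y h := Subtype.ext (hw.anticommute x y h)

instance {ι : Type*} : Nontrivial (lp (fun _ : Finset ι => ℂ) 2) := by
  classical
  refine ⟨⟨lp.single 2 ∅ 1, 0, fun h => ?_⟩⟩
  have := congrArg (fun f : lp (fun _ : Finset ι => ℂ) 2 => f ∅) h
  simp at this

lemma isIrreducibleRep_of_mem_range {Z X B : Type*} [CStarAlgebra B] {R : Z → X → Prop}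
    (hR : SignSeparating R)
    {π : B →⋆ₐ[ℂ] (lp (fun _ : Finset X => ℂ) 2 →L[ℂ] lp (fun _ : Finset X => ℂ) 2)}
    (hT : ∀ x, toggleOp x ∈ Set.range π) (hM : ∀ z, signOp R z ∈ Set.range π) :
    IsIrreducibleRep π := by
  refine ⟨inferInstance, fun K hK hinv => eq_bot_or_eq_top_of_invariant R hR K hK ?_ ?_⟩
  · intro x f hf
    obtain ⟨b, hb⟩ := hT x
    exact hb ▸ hinv b f hf
  · intro z f hf
    obtain ⟨b, hb⟩ := hM z
    exact hb ▸ hinv b f hf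

theorem theorem1 :
    (∃ 𝔸 : Set (Set ℕ), DenseFamily 𝔸 ∧ IndependentFamily 𝔸 ∧
      Cardinal.mk 𝔸 = Cardinal.continuum) ∧
    ∀ 𝔸 : Set (Set ℕ), DenseFamily 𝔸 → IndependentFamily 𝔸 →
      Cardinal.mk 𝔸 = Cardinal.continuum →
      ∃ (B : Type) (_ : CStarAlgebra B) (u : ℕ ⊕ 𝔸 → B),
        IsGraphAlgebra.{w} (incidenceGraph 𝔸) u ∧
        IsSimpleCStarAlgebra B ∧
        IsNuclearCStarAlgebra.{w} B ∧
        (∃ (H : Type) (_ : NormedAddCommGroup H) (_ : InnerProductSpace ℂ H) (_ : CompleteSpace H)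
          (π : B →⋆ₐ[ℂ] (H →L[ℂ] H)),
          IsIrreducibleRep π ∧ TopologicalSpace.SeparableSpace H) ∧
        (∃ (H : Type) (_ : NormedAddCommGroup H) (_ : InnerProductSpace ℂ H) (_ : CompleteSpace H)
          (π : B →⋆ₐ[ℂ] (H →L[ℂ] H)),
          IsIrreducibleRep π ∧ ¬ TopologicalSpace.SeparableSpace H) := by
  refine ⟨exists_denseFamily_independentFamily, fun 𝔸 hd hi hc => ?_⟩
  have hG := signSeparating_incidenceGraph hd hi
  have hT := satisfiesGraphRelations_toggle_sign (𝔸 := 𝔸)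
  set S := (StarAlgebra.adjoin ℂ (Set.range (Sum.elim toggleOp
    (signOp fun (x : 𝔸) (i : ℕ) => i ∈ x.1)))).topologicalClosure with hS
  have hmem : ∀ v, Sum.elim toggleOp (signOp fun (x : 𝔸) (i : ℕ) => i ∈ x.1) v ∈ S := fun v =>
    StarSubalgebra.le_topologicalClosure _ (StarAlgebra.subset_adjoin _ _ ⟨v, rfl⟩)
  have hclosed : IsClosed
      (S : Set (lp (fun _ : Finset ℕ => ℂ) 2 →L[ℂ] lp (fun _ : Finset ℕ => ℂ) 2)) :=
    StarSubalgebra.isClosed_topologicalClosure _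
  have hu := hT.codRestrict S hmem
  have hgen := topologicalClosure_adjoin_range_codRestrict _ hmem
  refine ⟨S, inferInstance, _, hu.isGraphAlgebra hG hgen, hu.isSimpleCStarAlgebra hG hgen,
    hu.isNuclearCStarAlgebra hG hgen, ?_, ?_⟩
  · obtain ⟨π, hπ⟩ := (hu.isGraphAlgebra hG hgen).exists_lift _ _ hT
    exact ⟨lp (fun _ : Finset ℕ => ℂ) 2, inferInstance, inferInstance, inferInstance, π,
      isIrreducibleRep_of_mem_range hd.signSeparating (fun i => ⟨_, hπ (Sum.inl i)⟩)
        fun x => ⟨_, hπ (Sum.inr x)⟩, separableSpace_lp_two⟩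
  · obtain ⟨π, hπ⟩ := (hu.isGraphAlgebra hG hgen).exists_lift _ _
      (satisfiesGraphRelations_sign_toggle (𝔸 := 𝔸))
    have huncount : Uncountable 𝔸 := by
      rw [← Cardinal.aleph0_lt_mk_iff, hc]
      exact Cardinal.aleph0_lt_continuum
    have : Uncountable (Finset 𝔸) := Finset.singleton_injective.uncountable
    exact ⟨lp (fun _ : Finset 𝔸 => ℂ) 2, inferInstance, inferInstance, inferInstance, π,
      isIrreducibleRep_of_mem_range hi.signSeparating (fun x => ⟨_, hπ (Sum.inr x)⟩)
        fun i => ⟨_, hπ (Sum.inl i)⟩, not_separableSpace_lp_two⟩
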